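/- Let $V$ be a vertex operator algebra over $\mathbb C$ with vacuum $\mathbf 1$ and Virasoro element $\omega$, and write $Y(v,z)=\sum_{n\in\mathbb Z}v(n)z^{-n-1}$, $L(n)=\omega(n+1)$. By a $V$-module we mean a vector space with module vertex operators satisfying truncation ($v(n)x=0$ for $n\gg0$), the vacuum axiom, the Virasoro relations with the central charge of $V$, the $L(-1)$-derivative property, commutativity and associativity, which is the direct sum of the eigenspaces $M_h$ of $L(0)$ ($h\in\mathbb C$), all of finite dimension, with $M_{h-n}=0$ for every $h$ and all sufficiently large integers $n$. Let $U,W$ be $V$-modules and let $I(u,z)=\sum_{r\in\mathbb C}u(r)z^{-r-1}$ be an intertwining operator of type $\binom{W}{U\;\,W}$. For $u\in U_h$ put $o(u)=u(h-1)\in\mathrm{End}(W)$, and extend linearly to $U$; the operator $o(u)$ preserves each $W_s$. Let $$\mathrm{tr}_W\,o(u)q^{L(0)}=\sum_{s\in\mathbb C}\mathrm{tr}_{W_s}(o(u))\,q^s .$$ For $a\in V$ of weight $d$, $m\in\mathbb Z$ and $u\in U$ put $$a[m]u=\mathrm{Res}_x\,Y(a,x)u\,(\log(1+x))^m(1+x)^{d-1},$$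 extended linearly to $a\in V$ (equivalently, $\sum_m a[m]u\,z^{-m-1}=Y(a,e^z-1)e^{dz}u$). For $k\ge2$ let $$E_{2k}(\tau)=\frac1{(2\pi i)^{2k}}\sum_{(m,n)\ne(0,0)}\frac1{(m\tau+n)^{2k}}=\frac{2\zeta(2k)}{(2\pi i)^{2k}}+\frac2{(2k-1)!}\sum_{n\ge1}\frac{n^{2k-1}q^n}{1-q^n},\qquad q=e^{2\pi i\tau}.$$ Theorem. For all $a\in V$ and $u\in U$ one has $a[2k-2]u=0$ for all large $k$, and the following identities of formal series in complex powers of $q$ hold, where $E_{2k}$ stands for its $q$-expansion: $$\mathrm{tr}_W\,o(a[0]u)q^{L(0)}=0,$$ $$\mathrm{tr}_W\,o(a[-2]u)q^{L(0)}+\sum_{k\ge2}(2k-1)E_{2k}(\tau)\,\mathrm{tr}_W\,o(a[2k-2]u)q^{L(0)}=0 .$$ Moreover, if $\tau$ is a point of the upper half plane at which the series $\mathrm{tr}_W\,o(a[2k-2]u)q^{L(0)}$, with $q^s=e^{2\pi i\tau s}$, converges absolutely for every $k\ge2$, then so does $\mathrm{tr}_W\,o(a[-2]u)q^{L(0)}$,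 and the second identity holds between the values at $\tau$. -/

import Mathlib

open scoped UpperHalfPlane

noncomputable section

/-! ### Operator-valued formal series

A formal series `∑ A(r) z^{-r-1}` is recorded by its modes `r ↦ A(r)`; the exponents run through
`ℤ` for vertex operators and through `ℂ` for intertwining operators. -/

/-- Commutativity: `(z-w)^N (P₃(z) A(w) - A(w) P₂(z)) = 0` for some (hence every large) `N`,
written out as the vanishing of the coefficient of `z^{-m-1} w^{-k-1}` for all `m`, `k`. -/
def ModesCommute {G M₂ M₃ : Type*} [AddGroupWithOne G]
    [AddCommGroup M₂] [Module ℂ M₂] [AddCommGroup M₃] [Module ℂ M₃]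
    (P₃ : ℤ → Module.End ℂ M₃) (P₂ : ℤ → Module.End ℂ M₂) (A : G → M₂ →ₗ[ℂ] M₃) : Prop :=
  ∃ N : ℕ, ∀ (m : ℤ) (k : G),
    ∑ j ∈ Finset.range (N + 1), ((-1 : ℂ) ^ j * (N.choose j : ℂ)) •
      (P₃ (m + N - j) ∘ₗ A (k + j) - A (k + j) ∘ₗ P₂ (m + N - j)) = 0

/-- Associativity: with `B n` the modes attached to the `n`-th product,
`B n (z) = Res_w ((w-z)^n P₃(w) A(z) - (-z+w)^n A(z) P₂(w))`, where `(w-z)^n` is expanded in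
nonnegative powers of `z` and `(-z+w)^n` in nonnegative powers of `w`.
The sum over `i` is finite on every vector as soon as the modes of `A` and `P₂` truncate. -/
def ModesAssociate {G M₂ M₃ : Type*} [AddGroupWithOne G]
    [AddCommGroup M₂] [Module ℂ M₂] [AddCommGroup M₃] [Module ℂ M₃]
    (P₃ : ℤ → Module.End ℂ M₃) (P₂ : ℤ → Module.End ℂ M₂) (A : G → M₂ →ₗ[ℂ] M₃)
    (B : ℤ → G → M₂ →ₗ[ℂ] M₃) : Prop :=
  ∀ (n : ℤ) (r : G) (x : M₂), B n r x =
    ∑ᶠ i : ℕ, ((Ring.choose n i : ℤ) : ℂ) •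
      ((-1 : ℂ) ^ i • P₃ (n - i) (A (r + i) x)
        - (-1 : ℂ) ^ (n + (i : ℤ)) • A ((n : G) + r - i) (P₂ (i : ℤ) x))

/-- `L(n) = ω(n+1)` satisfy the Virasoro relations with central charge `c`. -/
def IsVirasoro {M : Type*} [AddCommGroup M] [Module ℂ M]
    (L : ℤ → Module.End ℂ M) (c : ℂ) : Prop :=
  ∀ m n : ℤ, L m * L n - L n * L m =
    ((m : ℂ) - n) • L (m + n) +
      (if m + n = 0 then (((m : ℂ) ^ 3 - m) / 12 * c) • (1 : Module.End ℂ M) else 0)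

/-- The projection onto the `i`-th summand of an internal direct sum. -/
def gradedProj {ι M : Type*} [DecidableEq ι] [AddCommGroup M] [Module ℂ M]
    {A : ι → Submodule ℂ M} (h : DirectSum.IsInternal A) (i : ι) : M →ₗ[ℂ] A i :=
  DirectSum.component ℂ ι (fun j => A j) i ∘ₗ
    (LinearEquiv.ofBijective (DirectSum.coeLinearMap A) h).symm.toLinearMap

/-! ### Vertex operator algebras, modules and intertwining operators -/

/-- A vertex operator algebra structure on the complex vector space `V`; `Y v n` is the mode
`v(n)` of `Y(v, z) = ∑ v(n) z^{-n-1}`, so that `L(n) = Y ω (n+1)`. -/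
structure VertexOperatorAlgebra (V : Type*) [AddCommGroup V] [Module ℂ V] where
  Y : V →ₗ[ℂ] (ℤ → Module.End ℂ V)
  vac : V
  ω : V
  c : ℂ
  truncation : ∀ u v : V, ∃ N : ℤ, ∀ n ≥ N, Y u n v = 0
  vacuum : ∀ n : ℤ, Y vac n = if n = -1 then 1 else 0
  creation : ∀ v : V, Y v (-1) vac = v
  creation_regular : ∀ (v : V) (n : ℤ), 0 ≤ n → Y v n vac = 0
  virasoro : IsVirasoro (fun n => Y ω (n + 1)) c
  /-- `V` is the direct sum of the spaces `V_n = {v | L(0) v = n v}`, `n ∈ ℤ`. -/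
  grading : DirectSum.IsInternal fun n : ℤ => (Y ω 1).eigenspace (n : ℂ)
  finiteDimensional : ∀ n : ℤ, FiniteDimensional ℂ ((Y ω 1).eigenspace (n : ℂ))
  lowerBound : ∃ N : ℤ, ∀ n < N, (Y ω 1).eigenspace (n : ℂ) = ⊥
  vac_weight : vac ∈ (Y ω 1).eigenspace 0
  ω_weight : ω ∈ (Y ω 1).eigenspace 2
  /-- `Y(L(-1)v, z) = d/dz Y(v, z)`. -/
  derivative : ∀ (v : V) (n : ℤ), Y (Y ω 0 v) n = (-(n : ℂ)) • Y v (n - 1)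
  commutativity : ∀ u v : V, ModesCommute (Y u) (Y u) (Y v)

/-- A module structure on `M` for the vertex operator algebra `𝒱`. It is graded by the
eigenvalues of `L(0)` (which acts semisimply), the eigenspaces `M_h` are finite dimensional, and
`M_{h-n} = 0` for every `h` and all large `n`. -/
structure VOAModule {V : Type*} [AddCommGroup V] [Module ℂ V] (𝒱 : VertexOperatorAlgebra V)
    (M : Type*) [AddCommGroup M] [Module ℂ M] where
  Y : V →ₗ[ℂ] (ℤ → Module.End ℂ M)
  truncation : ∀ (v : V) (x : M), ∃ N : ℤ, ∀ n ≥ N, Y v n x = 0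
  vacuum : ∀ n : ℤ, Y 𝒱.vac n = if n = -1 then 1 else 0
  virasoro : IsVirasoro (fun n => Y 𝒱.ω (n + 1)) 𝒱.c
  derivative : ∀ (v : V) (n : ℤ), Y (𝒱.Y 𝒱.ω 0 v) n = (-(n : ℂ)) • Y v (n - 1)
  grading : DirectSum.IsInternal fun h : ℂ => (Y 𝒱.ω 1).eigenspace h
  finiteDimensional : ∀ h : ℂ, FiniteDimensional ℂ ((Y 𝒱.ω 1).eigenspace h)
  lowerBound : ∀ h : ℂ, ∃ N : ℕ, ∀ n ≥ N, (Y 𝒱.ω 1).eigenspace (h - (n : ℂ)) = ⊥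
  commutativity : ∀ u v : V, ModesCommute (Y u) (Y u) (Y v)
  associativity : ∀ u v : V, ModesAssociate (Y u) (Y u) (Y v) (fun n => Y (𝒱.Y u n v))

section

variable {V M : Type*} [AddCommGroup V] [Module ℂ V] [AddCommGroup M] [Module ℂ M]
  {𝒱 : VertexOperatorAlgebra V}

/-- The operator `L(0)` of a module. -/
def VOAModule.L0 (𝓜 : VOAModule 𝒱 M) : Module.End ℂ M := 𝓜.Y 𝒱.ω 1

/-- The operator `L(-1)` of a module. -/
def VOAModule.Lneg1 (𝓜 : VOAModule 𝒱 M) : Module.End ℂ M := 𝓜.Y 𝒱.ω 0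

/-- The component of weight `n` of an element of `V`. -/
def VertexOperatorAlgebra.weightProj (𝒱 : VertexOperatorAlgebra V) (n : ℤ) :
    V →ₗ[ℂ] (𝒱.Y 𝒱.ω 1).eigenspace (n : ℂ) :=
  gradedProj 𝒱.grading n

/-- The component of weight `h` of an element of a module. -/
def VOAModule.weightProj (𝓜 : VOAModule 𝒱 M) (h : ℂ) : M →ₗ[ℂ] 𝓜.L0.eigenspace h :=
  gradedProj (A := fun h : ℂ => 𝓜.L0.eigenspace h) 𝓜.grading h

end

/-- An intertwining operator of type `(M₃ ; M₁ M₂)`: `I u r` is the mode `u(r)`, `r ∈ ℂ`, of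
`I(u, z) = ∑ u(r) z^{-r-1}`. -/
structure IntertwiningOperator {V M₁ M₂ M₃ : Type*} [AddCommGroup V] [Module ℂ V]
    [AddCommGroup M₁] [Module ℂ M₁] [AddCommGroup M₂] [Module ℂ M₂]
    [AddCommGroup M₃] [Module ℂ M₃] {𝒱 : VertexOperatorAlgebra V}
    (𝓜₁ : VOAModule 𝒱 M₁) (𝓜₂ : VOAModule 𝒱 M₂) (𝓜₃ : VOAModule 𝒱 M₃) where
  I : M₁ →ₗ[ℂ] (ℂ → M₂ →ₗ[ℂ] M₃)
  truncation : ∀ (u : M₁) (x : M₂) (r : ℂ), ∃ N : ℕ, ∀ n ≥ N, I u (r + (n : ℂ)) x = 0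
  derivative : ∀ (u : M₁) (r : ℂ), I (𝓜₁.Lneg1 u) r = (-r) • I u (r - 1)
  commutativity : ∀ (v : V) (u : M₁), ModesCommute (𝓜₃.Y v) (𝓜₂.Y v) (I u)
  associativity : ∀ (v : V) (u : M₁),
    ModesAssociate (𝓜₃.Y v) (𝓜₂.Y v) (I u) (fun n => I (𝓜₁.Y v n u))

/-! ### The square bracket modes -/

/-- The formal series `log(1+x) = ∑_{n ≥ 1} (-1)^{n+1} x^n / n`. -/
def logOnePlusX : LaurentSeries ℂ :=
  HahnSeries.ofPowerSeries ℤ ℂ (PowerSeries.mk fun n => if n = 0 then 0 else (-1) ^ (n + 1) / (n : ℂ))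

/-- The coefficient of `x^i` in `(log(1+x))^m (1+x)^{d-1}`, a formal Laurent series in `x`. -/
def bracketCoeff (d m i : ℤ) : ℂ :=
  (logOnePlusX ^ m * (1 + HahnSeries.single 1 1 : LaurentSeries ℂ) ^ (d - 1)).coeff i

section

variable {V M : Type*} [AddCommGroup V] [Module ℂ V] [AddCommGroup M] [Module ℂ M]
  {𝒱 : VertexOperatorAlgebra V}

/-- `a[m]u`: for `a` of weight `d` it is `Res_x Y(a, x) (log(1+x))^m (1+x)^{d-1} u`, which is the
coefficient of `z^{-m-1}` in `Y[a, z]u = Y(a, e^z - 1) e^{dz} u`; it is extended linearly to all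
`a`. Both sums have finitely many nonzero terms. -/
def VOAModule.bracket (𝓜 : VOAModule 𝒱 M) (a : V) (m : ℤ) (u : M) : M :=
  ∑ᶠ d : ℤ, ∑ᶠ i : ℤ, bracketCoeff d m i • 𝓜.Y (𝒱.weightProj d a : V) i u

end

/-! ### Trace functions

A formal series `∑_{s ∈ ℂ} t(s) q^s` is recorded by its coefficient function `t : ℂ → ℂ`. -/

section

variable {V U W : Type*} [AddCommGroup V] [Module ℂ V] [AddCommGroup U] [Module ℂ U]
  [AddCommGroup W] [Module ℂ W] {𝒱 : VertexOperatorAlgebra V}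
  {𝓤 : VOAModule 𝒱 U} {𝓦 : VOAModule 𝒱 W}

/-- The grade-preserving operator `o(u) = u(wt u - 1)`, extended linearly to all `u`. -/
def IntertwiningOperator.o (I : IntertwiningOperator 𝓤 𝓦 𝓦) (u : U) : Module.End ℂ W :=
  ∑ᶠ h : ℂ, I.I (𝓤.weightProj h u : U) (h - 1)

/-- The formal series `tr_W o(u) q^{L(0)}`: the coefficient of `q^s` is the trace of `o(u)` on the
finite dimensional `L(0)`-eigenspace `W_s`. -/
def IntertwiningOperator.trace (I : IntertwiningOperator 𝓤 𝓦 𝓦) (u : U) : ℂ → ℂ := fun s =>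
  LinearMap.trace ℂ (𝓦.L0.eigenspace s)
    (𝓦.weightProj s ∘ₗ I.o u ∘ₗ (𝓦.L0.eigenspace s).subtype)

end

/-- The term `t(s) q^s` at `q = exp(2πiτ)`, i.e. `t(s) exp(2πiτs)`. -/
def qTerm (t : ℂ → ℂ) (τ : ℍ) (s : ℂ) : ℂ :=
  t s * Complex.exp (2 * Real.pi * Complex.I * (τ : ℂ) * s)

/-- Absolute convergence at `τ` of the formal series `∑ t(s) q^s`. -/
def QConverges (t : ℂ → ℂ) (τ : ℍ) : Prop := Summable (qTerm t τ)

/-- The value at `τ` of the formal series `∑ t(s) q^s`. -/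
def qValue (t : ℂ → ℂ) (τ : ℍ) : ℂ := ∑' s : ℂ, qTerm t τ s

/-- The product of a power series in `q` with a formal series `∑ t(s) q^s`. The sum is finite
if `t (s - n) = 0` for all large `n`, as is the case for trace series. -/
def qMul (e : PowerSeries ℂ) (t : ℂ → ℂ) : ℂ → ℂ := fun s =>
  ∑ᶠ n : ℕ, PowerSeries.coeff n e * t (s - (n : ℂ))

/-! ### Eisenstein series -/

/-- `E_k(τ) = (2πi)^{-k} ∑_{(m,n) ≠ (0,0)} (mτ+n)^{-k}`, used for even `k ≥ 4`. -/
def eisensteinFun (k : ℕ) (τ : ℍ) : ℂ :=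
  1 / (2 * Real.pi * Complex.I) ^ k *
    ∑' p : {p : ℤ × ℤ // p ≠ 0}, 1 / ((p.1.1 : ℂ) * (τ : ℂ) + (p.1.2 : ℂ)) ^ k

/-- The `q`-expansion of `E_k` for even `k`,
`E_k = 2ζ(k)/(2πi)^k + 2/(k-1)! ∑_{n ≥ 1} n^{k-1} q^n / (1 - q^n)`;
the coefficient of `q^n` in the last sum is the sum of `d^{k-1}` over the divisors `d` of `n`. -/
def eisensteinSeries_q (k : ℕ) : PowerSeries ℂ :=
  PowerSeries.mk fun n =>
    if n = 0 then 2 * riemannZeta k / (2 * Real.pi * Complex.I) ^ k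
    else 2 / ((k - 1).factorial : ℂ) * ∑ d ∈ n.divisors, (d : ℂ) ^ (k - 1)

end

/-! This is Zhu's recursion: the Jacobi identity combined with cyclicity of the trace. By
bilinearity, take `a` and `u` homogeneous of weights `d` and `h`, put `X = Res_x x^{-2}(1+x)^d
Y(a,x)u`, and compute the trace of `o(X)` in two ways.

Substituting `y = log(1+x)` in `e^y/(e^y-1)^2 = y^{-2} + ∑_{k≥1} (2k-1) c_{2k} y^{2k-2}`, where
`c_{2k} = -B_{2k}/(2k)!` is the constant term of `E_{2k}`, gives `X = a[-2]u + ∑ (2k-1) c_{2k}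
a[2k-2]u` (`choose_eq_sum_bracketCoeff`).

On the other hand, the Jacobi identity (`borcherds_identity`) writes `o(X)` as a sum of mode
products `a(d-1-m)u(h-1+m)` and `u(h-1-m)a(d-1+m)`, `m ≥ 1`, with coefficients `m` and `-m`
(`IntertwiningOperator.o_residue_modes`). Their commutators are `∑ n^k/k! o(a[k]u)` with `n = -m`
and `n = m` (`IntertwiningOperator.commutator_modes`). Cyclicity moves a trace from `W_s` to
`W_{s-m}` at the cost of a commutator; iterating until the weight spaces vanish produces
`q^m/(1-q^m)`. Odd powers of `m` cancel, even ones double, and sorting by divisors leaves minus the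
nonconstant parts of the `E_{2k}` (`IntertwiningOperator.trace_residue`).

Equating the two gives the second identity with an extra `k = 1` term, in which `E_2` is only a
formal series. That term vanishes because `tr o(a[0]u)` is the trace of a commutator, which is the
first identity. The values at `τ` follow by multiplying absolutely convergent series. -/

noncomputable section

/-! ### Substituting `log(1+x)` into power series -/

section LogSubst

open PowerSeries HahnSeries

/-- `log(1+x)` is the series `PowerSeries.log`. -/
theorem logOnePlusX_eq : logOnePlusX = ofPowerSeries ℤ ℂ (PowerSeries.log ℂ) := by
  unfold logOnePlusX
  congr 1
  ext n
  simp only [coeff_mk, coeff_log]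
  split_ifs <;> simp

theorem one_add_X_mul_deriv_log : (1 + X : ℂ⟦X⟧) * d⁄dX ℂ (PowerSeries.log ℂ) = 1 := by
  rw [deriv_log]
  ext n
  rw [add_mul, one_mul, map_add]
  cases n with
  | zero => simp
  | succ n => simp [coeff_succ_X_mul, pow_succ]

/-- `exp(log(1+x)) = 1 + x`. -/
theorem exp_subst_log : (exp ℂ).subst (PowerSeries.log ℂ) = (1 + X : ℂ⟦X⟧) := by
  set f : ℂ⟦X⟧ := (exp ℂ).subst (PowerSeries.log ℂ) with hf
  set L : ℂ⟦X⟧ := d⁄dX ℂ (PowerSeries.log ℂ) with hL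
  have hL1 : (1 + X : ℂ⟦X⟧) * L = 1 := one_add_X_mul_deriv_log
  have hf' : d⁄dX ℂ f = f * L := by
    rw [hf, derivative_subst HasSubst.log, derivative_exp]
  have hf0 : constantCoeff f = 1 := by
    have h := HasSubst.log (A := ℂ)
    rw [hf, ← coeff_zero_eq_constantCoeff_apply, coeff_subst' h, finsum_eq_single _ 0]
    · simp
    · intro n hn
      simp [hn]
  have hL' : d⁄dX ℂ L = -(L * L) := by
    have h := congrArg (d⁄dX ℂ) hL1
    rw [Derivation.leibniz] at h
    simp only [smul_eq_mul, map_add, derivative_one, derivative_X, zero_add, mul_one] at h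
    have h2 : L * ((1 + X) * d⁄dX ℂ L + L) = 0 := by rw [h]; simp
    linear_combination h2 - d⁄dX ℂ L * hL1
  -- `L` is `1/(1+x)`. Since `f' = fL` and `L' = -L²`, the product `fL` has derivative zero and
  -- constant term one.
  have hg : f * L = 1 := by
    apply derivative.ext (R := ℂ)
    · rw [Derivation.leibniz, hf', hL']
      simp only [smul_eq_mul, derivative_one]
      ring
    · have h := congrArg constantCoeff hL1
      simp only [map_mul, map_add, map_one, constantCoeff_X, add_zero, one_mul] at h
      rw [map_mul, hf0, h]
      simp
  linear_combination (1 + X) * hg - f * hL1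

/-- An exponential law determines a function on `ℤ`. -/
theorem eq_zpow_of_map_add {K : Type*} [Field K] (φ : ℤ → K) (h0 : φ 0 = 1)
    (hadd : ∀ a b, φ (a + b) = φ a * φ b) (n : ℤ) : φ n = φ 1 ^ n := by
  have h1 : φ 1 ≠ 0 := by
    intro h
    have h2 := hadd 1 (-1)
    simp [h, h0] at h2
  induction n with
  | zero => simp [h0]
  | succ n ih => rw [hadd, ih, zpow_add_one₀ h1]
  | pred n ih =>
    rw [zpow_sub_one₀ h1, ← ih, eq_mul_inv_iff_mul_eq₀ h1, ← hadd, sub_add_cancel]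

theorem one_add_single_eq : (1 + single 1 1 : LaurentSeries ℂ) = ofPowerSeries ℤ ℂ (1 + X) := by
  simp

/-- The binomial expansion of `(1+x)^m`, `m ∈ ℤ`. -/
theorem one_add_single_zpow (m : ℤ) :
    (1 + single 1 1 : LaurentSeries ℂ) ^ m = ofPowerSeries ℤ ℂ (binomialSeries ℂ m) := by
  rw [eq_zpow_of_map_add (fun m : ℤ => ofPowerSeries ℤ ℂ (binomialSeries ℂ m)) _ _ m]
  · have h := binomialSeries_nat (R := ℤ) (A := ℂ) 1
    simp only [Nat.cast_one, pow_one] at h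
    rw [h, one_add_single_eq]
  · simp
  · intro a b
    simp

/-- As functions of `m` both sides turn sums into products, so only `m = 1` matters, and that is
`exp_subst_log`. -/
theorem ofPowerSeries_rescale_exp_subst_log (m : ℤ) :
    ofPowerSeries ℤ ℂ ((rescale (m : ℂ) (exp ℂ)).subst (PowerSeries.log ℂ)) =
      (1 + single 1 1 : LaurentSeries ℂ) ^ m := by
  rw [eq_zpow_of_map_add (fun m : ℤ =>
    ofPowerSeries ℤ ℂ ((rescale (m : ℂ) (exp ℂ)).subst (PowerSeries.log ℂ))) _ _ m]
  · simp only [Int.cast_one, rescale_one, RingHom.id_apply, exp_subst_log, one_add_single_eq]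
  · have h : rescale (0 : ℂ) (exp ℂ) = 1 := by simp
    simp only [Int.cast_zero, h, ← coe_substAlgHom (HasSubst.log (A := ℂ)), map_one]
  · intro a b
    simp only [Int.cast_add, ← exp_mul_exp_eq_exp_add, ← coe_substAlgHom (HasSubst.log (A := ℂ)),
      map_mul]

theorem LaurentSeries.order_zpow {f : LaurentSeries ℂ} (hf : f ≠ 0) (n : ℤ) :
    (f ^ n).order = n * f.order := by
  have hinv : (f⁻¹).order = -f.order := by
    have h := order_mul hf (inv_ne_zero hf)
    rw [mul_inv_cancel₀ hf, HahnSeries.order_one] at h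
    linarith
  cases n with
  | ofNat n => simp
  | negSucc n =>
    rw [zpow_negSucc, ← inv_pow, HahnSeries.order_pow, hinv, Int.negSucc_eq]
    simp
    ring

theorem coeff_logOnePlusX_zero_one : logOnePlusX.coeff 0 = 0 ∧ logOnePlusX.coeff 1 = 1 := by
  rw [logOnePlusX_eq]
  constructor
  · exact (ofPowerSeries_apply_coeff _ 0).trans (by simp)
  · exact (ofPowerSeries_apply_coeff _ 1).trans (by simp)

theorem logOnePlusX_ne_zero : logOnePlusX ≠ 0 := by
  intro h
  have := coeff_logOnePlusX_zero_one.2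
  simp [h] at this

theorem coeff_ofPowerSeries_of_neg (f : ℂ⟦X⟧) {i : ℤ} (hi : i < 0) :
    (ofPowerSeries ℤ ℂ f).coeff i = 0 := by
  rw [PowerSeries.coeff_coe, if_pos hi]

theorem order_ofPowerSeries_nonneg (f : ℂ⟦X⟧) : 0 ≤ (ofPowerSeries ℤ ℂ f).order := by
  by_cases hf : ofPowerSeries ℤ ℂ f = 0
  · simp [hf]
  · by_contra! h
    exact coeff_order_eq_zero.not.mpr hf (coeff_ofPowerSeries_of_neg f h)

theorem order_logOnePlusX : logOnePlusX.order = 1 := by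
  have h1 : logOnePlusX.order ≤ 1 := by
    apply order_le_of_coeff_ne_zero
    simp [coeff_logOnePlusX_zero_one.2]
  have h0 : 0 ≤ logOnePlusX.order := by
    rw [logOnePlusX_eq]
    exact order_ofPowerSeries_nonneg _
  have h2 : logOnePlusX.order ≠ 0 := by
    intro h
    apply coeff_order_eq_zero.not.mpr logOnePlusX_ne_zero
    rw [h]
    exact coeff_logOnePlusX_zero_one.1
  lia

/-- `log(1+x)` has order one, and a power series factor cannot lower the order of a product. -/
theorem coeff_logOnePlusX_zpow_mul (m i : ℤ) (hi : i < m) (f : ℂ⟦X⟧) :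
    (logOnePlusX ^ m * ofPowerSeries ℤ ℂ f).coeff i = 0 := by
  by_cases hf : ofPowerSeries ℤ ℂ f = 0
  · simp [hf]
  · apply coeff_eq_zero_of_lt_order
    rw [order_mul (zpow_ne_zero _ logOnePlusX_ne_zero) hf,
      LaurentSeries.order_zpow logOnePlusX_ne_zero, order_logOnePlusX]
    have := order_ofPowerSeries_nonneg f
    lia

/-- The order of `(log(1+x))^m (1+x)^{d-1}` is at least `m`. -/
theorem bracketCoeff_eq_zero (d m i : ℤ) (hi : i < m) : bracketCoeff d m i = 0 := by
  unfold bracketCoeff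
  rw [one_add_single_zpow]
  exact coeff_logOnePlusX_zpow_mul m i hi _

/-- The coefficients of `(log(1+x))^m f(log(1+x)) (1+x)^{d-1}`. -/
theorem coeff_log_zpow_mul_subst_log (d m i : ℤ) (K : ℕ) (hi : i < m + K) (f : ℂ⟦X⟧) :
    (logOnePlusX ^ m * ofPowerSeries ℤ ℂ (f.subst (PowerSeries.log ℂ)) *
      (1 + single 1 1 : LaurentSeries ℂ) ^ (d - 1)).coeff i =
      ∑ k ∈ Finset.range K, PowerSeries.coeff k f * bracketCoeff d (m + k) i := by
  -- The tail `X^K g` of `f` contributes a series starting at `x^{m+K}`, beyond the exponent `i`;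
  -- only the truncation of `f` at degree `K` is seen.
  obtain ⟨g, hg⟩ : ∃ g : ℂ⟦X⟧,
      f = ∑ k ∈ Finset.range K, C (PowerSeries.coeff k f) * X ^ k + X ^ K * g := by
    have h : (X : ℂ⟦X⟧) ^ K ∣ f - ∑ k ∈ Finset.range K, C (PowerSeries.coeff k f) * X ^ k := by
      rw [X_pow_dvd_iff]
      intro j hj
      simp [PowerSeries.coeff_X_pow, hj]
    obtain ⟨g, hg⟩ := h
    exact ⟨g, by rw [← hg]; ring⟩
  have hs := HasSubst.log (A := ℂ)
  have h1 : f.subst (PowerSeries.log ℂ) =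
      ∑ k ∈ Finset.range K, C (PowerSeries.coeff k f) * PowerSeries.log ℂ ^ k +
        PowerSeries.log ℂ ^ K * g.subst (PowerSeries.log ℂ) := by
    have hC (c : ℂ) : (C c : ℂ⟦X⟧).subst (PowerSeries.log ℂ) = C c := subst_C c
    conv_lhs => rw [hg]
    simp only [← coe_substAlgHom hs, map_add, map_mul, map_pow, map_sum, substAlgHom_X hs]
    simp only [coe_substAlgHom hs, hC]
  have h2 (k : ℕ) : logOnePlusX ^ m * ofPowerSeries ℤ ℂ (PowerSeries.log ℂ ^ k) =
      logOnePlusX ^ (m + k) := by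
    rw [map_pow, ← logOnePlusX_eq, zpow_add₀ logOnePlusX_ne_zero, zpow_natCast]
  rw [h1, map_add, map_mul, mul_add, ← mul_assoc, h2, map_sum, Finset.mul_sum, add_mul,
    HahnSeries.coeff_add, mul_assoc, one_add_single_zpow, ← map_mul,
    coeff_logOnePlusX_zpow_mul _ _ hi, add_zero, Finset.sum_mul, coeff_sum]
  refine Finset.sum_congr rfl fun k _ => ?_
  rw [map_mul, ofPowerSeries_C, mul_left_comm, h2, mul_assoc, C_mul_eq_smul,
    HahnSeries.coeff_smul, ← one_add_single_zpow, bracketCoeff, smul_eq_mul]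

theorem coeff_one_add_single_zpow (m : ℤ) (i : ℕ) :
    ((1 + single 1 1 : LaurentSeries ℂ) ^ m).coeff (i : ℤ) = ((Ring.choose m i : ℤ) : ℂ) := by
  rw [one_add_single_zpow, ofPowerSeries_apply_coeff]
  simp

/-- `(1+x)^{n+d-1} = ∑ n^k/k! (log(1+x))^k (1+x)^{d-1}`. -/
theorem sum_pow_mul_bracketCoeff (d n : ℤ) (i K : ℕ) (hi : i < K) :
    ∑ k ∈ Finset.range K, (n : ℂ) ^ k / (k.factorial : ℂ) * bracketCoeff d k i =
      ((Ring.choose (n + d - 1) i : ℤ) : ℂ) := by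
  -- Here `f(y) = e^{ny}`, which becomes `(1+x)^n` at `y = log(1+x)`.
  have h := coeff_log_zpow_mul_subst_log d 0 i K (by lia) (rescale (n : ℂ) (exp ℂ))
  rw [zpow_zero, one_mul, ofPowerSeries_rescale_exp_subst_log, ← zpow_add₀,
    show n + (d - 1) = n + d - 1 by ring, coeff_one_add_single_zpow] at h
  · rw [h]
    refine Finset.sum_congr rfl fun k _ => ?_
    rw [coeff_rescale, coeff_exp, zero_add]
    simp
    ring_nf
    simp
  · rw [one_add_single_eq]
    intro h0
    have := congrArg (fun f : LaurentSeries ℂ => f.coeff ((0 : ℕ) : ℤ)) h0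
    rw [ofPowerSeries_apply_coeff] at this
    simp at this

end LogSubst

/-! ### Bernoulli numbers and the constant terms of the Eisenstein series. -/

section BernoulliExpansion

open PowerSeries HahnSeries

/-- `y² e^y / (e^y - 1)²` as a power series in `y`. -/
def invSinhSqSeries : ℂ⟦X⟧ :=
  bernoulliPowerSeries ℂ - X * d⁄dX ℂ (bernoulliPowerSeries ℂ)

theorem coeff_invSinhSqSeries (n : ℕ) :
    PowerSeries.coeff n invSinhSqSeries = (1 - (n : ℂ)) * ((bernoulli n : ℂ) / n.factorial) := by
  unfold invSinhSqSeries
  rw [map_sub]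
  cases n with
  | zero => simp [bernoulliPowerSeries]
  | succ n =>
    rw [coeff_succ_X_mul, coeff_derivative]
    simp [bernoulliPowerSeries]
    ring

/-- With `b = y/(e^y-1)`, the series is `-y² (b/y)' = b - y b'`. The proof combines `b(e^y-1) = y`
with its derivative, avoiding division by `y`. -/
theorem invSinhSqSeries_mul : invSinhSqSeries * (exp ℂ - 1) ^ 2 = X ^ 2 * exp ℂ := by
  unfold invSinhSqSeries
  have h := bernoulliPowerSeries_mul_exp_sub_one ℂ
  set b := bernoulliPowerSeries ℂ
  have h' := congrArg (d⁄dX ℂ) h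
  rw [Derivation.leibniz, derivative_X, map_sub, derivative_exp, derivative_one] at h'
  simp only [smul_eq_mul, sub_zero] at h'
  linear_combination (X * exp ℂ + (exp ℂ - 1)) * h - X * (exp ℂ - 1) * h'

/-- At `y = log(1+x)` one has `e^y = 1+x` and `e^y - 1 = x`, so `e^y/(e^y-1)²` becomes
`x^{-2}(1+x)`. -/
theorem log_zpow_mul_invSinhSqSeries_subst (d : ℤ) :
    logOnePlusX ^ (-2 : ℤ) * ofPowerSeries ℤ ℂ (invSinhSqSeries.subst (PowerSeries.log ℂ)) *
      (1 + single 1 1 : LaurentSeries ℂ) ^ (d - 1) =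
    single (-2) 1 * (1 + single 1 1 : LaurentSeries ℂ) ^ d := by
  have hs := HasSubst.log (A := ℂ)
  have h := congrArg (PowerSeries.subst (PowerSeries.log ℂ)) invSinhSqSeries_mul
  simp only [← coe_substAlgHom hs, map_mul, map_pow, map_sub, map_one, substAlgHom_X hs] at h
  simp only [coe_substAlgHom hs, exp_subst_log, add_sub_cancel_left] at h
  have h2 := congrArg (ofPowerSeries ℤ ℂ) h
  rw [map_mul, map_mul, map_pow, map_pow, ← logOnePlusX_eq, ← one_add_single_eq,
    ofPowerSeries_X] at h2
  have hx : (single (-2 : ℤ) (1 : ℂ) : LaurentSeries ℂ) * single 1 1 ^ 2 = 1 := by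
    rw [single_pow, single_mul_single]
    simp
  have hne : (1 + single 1 1 : LaurentSeries ℂ) ≠ 0 := by
    rw [one_add_single_eq]
    intro h0
    have := congrArg (fun f : LaurentSeries ℂ => f.coeff ((0 : ℕ) : ℤ)) h0
    rw [ofPowerSeries_apply_coeff] at this
    simp at this
  have hl : logOnePlusX ^ (-2 : ℤ) * logOnePlusX ^ 2 = 1 := by
    rw [zpow_neg]
    exact inv_mul_cancel₀ (pow_ne_zero _ logOnePlusX_ne_zero)
  have hd : (1 + single 1 1 : LaurentSeries ℂ) ^ d = (1 + single 1 1 : LaurentSeries ℂ) ^ (d - 1) *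
      (1 + single 1 1 : LaurentSeries ℂ) := by
    rw [← zpow_add_one₀ hne, sub_add_cancel]
  rw [hd]
  linear_combination
    (logOnePlusX ^ (-2 : ℤ) * (1 + single 1 1 : LaurentSeries ℂ) ^ (d - 1) * single (-2 : ℤ) 1) * h2
    + single (-2 : ℤ) (1 : ℂ) * (1 + single 1 1 : LaurentSeries ℂ) ^ (d - 1) *
      (1 + single 1 1 : LaurentSeries ℂ) * hl
    - logOnePlusX ^ (-2 : ℤ) * ofPowerSeries ℤ ℂ (invSinhSqSeries.subst (PowerSeries.log ℂ)) *
      (1 + single 1 1 : LaurentSeries ℂ) ^ (d - 1) * hx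

/-- The constant term of `E_{2k}` is `-B_{2k}/(2k)!`. -/
theorem coeff_zero_eisensteinSeries_q {k : ℕ} (hk : k ≠ 0) :
    PowerSeries.coeff 0 (eisensteinSeries_q (2 * k)) =
      -((bernoulli (2 * k) : ℂ) / (2 * k).factorial) := by
  have hpi : (Real.pi : ℂ) ≠ 0 := by exact_mod_cast Real.pi_ne_zero
  have h2 : (2 : ℂ) ^ (2 * k) = 2 * 2 ^ (2 * k - 1) := by
    rw [← pow_succ', Nat.sub_add_cancel (by lia)]
  have h1 : ((-1 : ℂ) ^ k) * (-1) ^ k = 1 := by rw [← mul_pow]; simp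
  have hf : ((2 * k).factorial : ℂ) ≠ 0 := by exact_mod_cast Nat.factorial_ne_zero _
  have h3 : (-1 : ℂ) ^ k ≠ 0 := by simp
  rw [eisensteinSeries_q, coeff_mk, if_pos rfl]
  push_cast
  rw [riemannZeta_two_mul_nat hk, mul_pow, mul_pow, pow_mul Complex.I, Complex.I_sq, h2]
  field_simp
  ring_nf

theorem sum_range_two_mul {M : Type*} [AddCommMonoid M] (f : ℕ → M) (K : ℕ) :
    ∑ k ∈ Finset.range (2 * K), f k = ∑ k ∈ Finset.range K, (f (2 * k) + f (2 * k + 1)) := by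
  induction K with
  | zero => simp
  | succ K ih =>
    rw [show 2 * (K + 1) = 2 * K + 1 + 1 by ring, Finset.sum_range_succ, Finset.sum_range_succ, ih,
      Finset.sum_range_succ, add_assoc]

/-- `x^{-2}(1+x)^d` in terms of `log(1+x)`:
`e^y/(e^y-1)^2 = y^{-2} + ∑_{k ≥ 1} (2k-1) c_{2k} y^{2k-2}` with `c_{2k}` the constant term of
`E_{2k}`. -/
theorem choose_eq_sum_bracketCoeff (d : ℤ) (j K : ℕ) (hj : j < 2 * K) :
    ((Ring.choose d j : ℤ) : ℂ) = bracketCoeff d (-2) (j - 2) +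
      ∑ k ∈ Finset.Ico 1 K, (2 * (k : ℂ) - 1) * PowerSeries.coeff 0 (eisensteinSeries_q (2 * k)) *
        bracketCoeff d (2 * k - 2) (j - 2) := by
  have h := coeff_log_zpow_mul_subst_log d (-2) (j - 2) (2 * K) (by push_cast; lia) invSinhSqSeries
  have h' : (single (-2) 1 * (1 + single 1 1 : LaurentSeries ℂ) ^ d).coeff ((j : ℤ) - 2) =
      ((Ring.choose d j : ℤ) : ℂ) := by
    have := coeff_single_mul_add (r := (1 : ℂ)) (x := (1 + single 1 1 : LaurentSeries ℂ) ^ d)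
      (a := (j : ℤ)) (b := -2)
    rw [sub_eq_add_neg, this, coeff_one_add_single_zpow, one_mul]
  rw [log_zpow_mul_invSinhSqSeries_subst, h', sum_range_two_mul] at h
  have hK : 0 < K := by lia
  rw [h, Finset.range_eq_Ico, Finset.sum_eq_sum_Ico_succ_bot hK]
  -- In degree one the factor `1 - n` vanishes, although `B_1` does not; in higher odd degrees the
  -- Bernoulli number vanishes.
  have hodd (k : ℕ) : PowerSeries.coeff (2 * k + 1) invSinhSqSeries = 0 := by
    rw [coeff_invSinhSqSeries]
    rcases Nat.eq_zero_or_pos k with rfl | hk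
    · simp
    · rw [bernoulli_eq_zero_of_odd ⟨k, rfl⟩ (by lia)]
      simp
  congr 1
  · rw [hodd]
    simp [coeff_invSinhSqSeries]
  · refine Finset.sum_congr rfl fun k hk => ?_
    rw [Finset.mem_Ico] at hk
    rw [hodd, coeff_zero_eisensteinSeries_q (by lia), coeff_invSinhSqSeries]
    push_cast
    rw [show (-2 : ℤ) + 2 * k = 2 * k - 2 by ring]
    ring

end BernoulliExpansion

/-! ### The Borcherds identity -/

section Borcherds

theorem finsum_eq_sum_range_of_eq_zero {M : Type*} [AddCommMonoid M] (F : ℕ → M) (N : ℕ)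
    (h : ∀ i ≥ N, F i = 0) :
    ∑ᶠ i, F i = ∑ i ∈ Finset.range N, F i := by
  apply finsum_eq_sum_of_support_subset
  intro i hi
  by_contra hn
  apply hi
  apply h
  simpa using hn

open Filter

/-- The sum `∑ i, C(p, i) F(i)` for an eventually vanishing sequence `F`. -/
def binSum {M : Type*} [AddCommGroup M] [Module ℂ M] (p : ℤ) (F : ℕ → M) : M :=
  ∑ᶠ i : ℕ, ((Ring.choose p i : ℤ) : ℂ) • F i

section

variable {M : Type*} [AddCommGroup M] [Module ℂ M]

theorem binSum_eq_sum_range (p : ℤ) (F : ℕ → M) (N : ℕ) (h : ∀ i ≥ N, F i = 0) :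
    binSum p F = ∑ i ∈ Finset.range N, ((Ring.choose p i : ℤ) : ℂ) • F i :=
  finsum_eq_sum_range_of_eq_zero _ N fun i hi => by rw [h i hi, smul_zero]

theorem binSum_neg (p : ℤ) (F : ℕ → M) : binSum p (fun i => -F i) = -binSum p F := by
  simp only [binSum, smul_neg, finsum_neg_distrib]

theorem binSum_of_eq_zero (p : ℤ) (F : ℕ → M) (h : ∀ i, F i = 0) : binSum p F = 0 := by
  simp [binSum, h]

theorem binSum_zero (F : ℕ → M) : binSum 0 F = F 0 := by
  unfold binSum
  rw [finsum_eq_single _ 0]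
  · simp
  · intro n hn
    rw [Ring.choose_zero_pos _ (Nat.pos_of_ne_zero hn)]
    simp

/-- Pascal's rule. -/
theorem binSum_add_one (p : ℤ) (F : ℕ → M) (hF : ∀ᶠ i in atTop, F i = 0) :
    binSum (p + 1) F = binSum p F + binSum p (fun i => F (i + 1)) := by
  obtain ⟨N, hN⟩ := eventually_atTop.mp hF
  have hN1 : ∀ i ≥ N + 1, F i = 0 := fun i hi => hN i (by lia)
  rw [binSum_eq_sum_range _ F (N + 1) hN1, binSum_eq_sum_range _ F (N + 1) hN1,
    binSum_eq_sum_range p _ N fun i hi => hN _ (by lia), Finset.sum_range_succ',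
    Finset.sum_range_succ']
  simp only [Ring.choose_succ_succ, Ring.choose_zero_right, Int.cast_add, add_smul,
    Finset.sum_add_distrib]
  abel

end

variable {G M₂ M₃ : Type*} [AddCommGroupWithOne G]
  [AddCommGroup M₂] [Module ℂ M₂] [AddCommGroup M₃] [Module ℂ M₃]
  {P₃ : ℤ → Module.End ℂ M₃} {P₂ : ℤ → Module.End ℂ M₂} {A : G → M₂ →ₗ[ℂ] M₃}
  {B : ℤ → G → M₂ →ₗ[ℂ] M₃}

/-- Commutativity and associativity imply the Borcherds (Jacobi) identity. -/
theorem borcherds_identity (hA : ∀ (r : G) (x : M₂), ∃ N : ℕ, ∀ n ≥ N, A (r + (n : ℕ)) x = 0)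
    (hP : ∀ x : M₂, ∃ N : ℤ, ∀ n ≥ N, P₂ n x = 0) (hB : ∃ N : ℤ, ∀ n ≥ N, B n = 0)
    (hcomm : ModesCommute P₃ P₂ A) (hassoc : ModesAssociate P₃ P₂ A B)
    (p n : ℤ) (r : G) (x : M₂) :
    binSum p (fun i => B (n + i) (p + r - i) x) =
      binSum n (fun i => (-1 : ℂ) ^ i • P₃ (p + n - i) (A (r + i) x)) -
      binSum n (fun i => (-1 : ℂ) ^ (n + (i : ℤ)) • A (n + r - i) (P₂ (p + i) x)) := by
  have one_ne : (-1 : ℂ) ≠ 0 := by simp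
  set L : ℤ → ℤ → G → M₃ := fun p n r => binSum p (fun i => B (n + i) (p + r - i) x) with hL
  set R₁ : ℤ → ℤ → G → M₃ := fun p n r =>
    binSum n (fun i => (-1 : ℂ) ^ i • P₃ (p + n - i) (A (r + i) x)) with hR₁
  set R₂ : ℤ → ℤ → G → M₃ := fun p n r =>
    binSum n (fun i => (-1 : ℂ) ^ (n + (i : ℤ)) • A (n + r - i) (P₂ (p + i) x)) with hR₂
  have hA' (r : G) : ∀ᶠ i : ℕ in atTop, A (r + i) x = 0 := eventually_atTop.mpr (hA r x)
  have hP' (p : ℤ) : ∀ᶠ i : ℕ in atTop, P₂ (p + i) x = 0 := by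
    obtain ⟨N, hN⟩ := hP x
    exact eventually_atTop.mpr ⟨(N - p).toNat, fun i hi => hN _ (by lia)⟩
  obtain ⟨NB, hNB⟩ := hB
  have hB' (n : ℤ) : ∀ᶠ i : ℕ in atTop, B (n + i) = 0 :=
    eventually_atTop.mpr ⟨(NB - n).toNat, fun i hi => hNB _ (by lia)⟩
  -- By Pascal's rule `L` and `R₁ - R₂` obey the same recursion in `(p, n, r)`, so it suffices to
  -- see that their difference vanishes for `p = 0` and, for negative `p`, for large `n`.
  have hLrec (p n : ℤ) (r : G) : L (p + 1) n r = L p (n + 1) r + L p n (r + 1) := by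
    simp only [hL]
    rw [binSum_add_one]
    · rw [add_comm]
      congr 2
      · ext i
        congr 2
        · push_cast
          abel_nf
        · push_cast
          abel_nf
      · ext i
        congr 2
        push_cast
        abel
    · filter_upwards [hB' n] with i hi
      simp [hi]
  have hR₁rec (p n : ℤ) (r : G) : R₁ p (n + 1) r = R₁ (p + 1) n r - R₁ p n (r + 1) := by
    simp only [hR₁]
    rw [binSum_add_one, sub_eq_add_neg, ← binSum_neg]
    · congr 2
      · ext i
        congr 3
        abel
      · ext i
        rw [pow_succ, mul_neg_one, neg_smul]
        congr 3
        · push_cast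
          abel_nf
        · push_cast
          abel_nf
    · filter_upwards [hA' r] with i hi
      simp [hi]
  have hR₂rec (p n : ℤ) (r : G) : R₂ p (n + 1) r = R₂ (p + 1) n r - R₂ p n (r + 1) := by
    simp only [hR₂]
    rw [binSum_add_one, sub_eq_add_neg, ← binSum_neg, add_comm]
    · congr 2
      · ext i
        rw [show (n + 1 + ((i + 1 : ℕ) : ℤ)) = n + i + 1 + 1 by push_cast; ring,
          zpow_add_one₀ one_ne, zpow_add_one₀ one_ne]
        simp only [mul_neg, mul_one, neg_neg]
        congr 2
        · push_cast
          abel_nf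
        · push_cast
          abel_nf
      · ext i
        rw [show n + 1 + (i : ℤ) = n + i + 1 by ring, zpow_add_one₀ one_ne, mul_neg_one, neg_smul]
        congr 3
        push_cast
        abel_nf
    · filter_upwards [hP' p] with i hi
      simp [hi]
  obtain ⟨NC, hNC⟩ := hcomm
  -- For `n = NC` both binomial sums are finite, and reversing the second one, `i ↦ NC - i`, yields
  -- exactly the commutativity relation.
  have hQ0 (p : ℤ) (r : G) : R₁ p NC r - R₂ p NC r = 0 := by
    have hz (i : ℕ) (hi : i ≥ NC + 1) : ((Ring.choose (NC : ℤ) i : ℤ) : ℂ) = 0 := by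
      rw [Ring.choose_natCast, Nat.choose_eq_zero_of_lt (by lia)]
      simp
    simp only [hR₁, hR₂, binSum]
    rw [finsum_eq_sum_range_of_eq_zero _ (NC + 1) (fun i hi => by rw [hz i hi, zero_smul]),
      finsum_eq_sum_range_of_eq_zero _ (NC + 1) (fun i hi => by rw [hz i hi, zero_smul])]
    rw [← Finset.sum_range_reflect (fun i => ((Ring.choose (NC : ℤ) i : ℤ) : ℂ) •
      (-1 : ℂ) ^ ((NC : ℤ) + (i : ℤ)) • A (((NC : ℤ) : G) + r - i) (P₂ (p + i) x)),
      ← Finset.sum_sub_distrib]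
    have h := congrArg (fun f : M₂ →ₗ[ℂ] M₃ => f x) (hNC p r)
    simp only [LinearMap.sum_apply, LinearMap.zero_apply] at h
    rw [← h]
    refine Finset.sum_congr rfl fun j hj => ?_
    have hj' : j ≤ NC := by simpa [Nat.lt_succ_iff] using hj
    have e1 : NC + 1 - 1 - j = NC - j := by lia
    have e2 : (((NC - j : ℕ) : ℤ)) = (NC : ℤ) - j := by lia
    have e3 : (((NC - j : ℕ) : G)) = (NC : G) - j := by rw [Nat.cast_sub hj']
    have e4 : (-1 : ℂ) ^ ((NC : ℤ) + ((NC : ℤ) - j)) = (-1) ^ j := by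
      rw [show (NC : ℤ) + ((NC : ℤ) - j) = 2 * (NC - j) + j by ring, zpow_add₀ one_ne, zpow_mul]
      simp
    rw [e1, e2, e3, e4, Ring.choose_natCast, Ring.choose_natCast, Nat.choose_symm hj',
      show ((NC : ℤ) : G) + r - ((NC : G) - j) = r + j by push_cast; abel,
      show p + ((NC : ℤ) - j) = p + NC - j by ring]
    simp only [LinearMap.smul_apply, LinearMap.sub_apply, LinearMap.comp_apply, smul_sub, smul_smul]
    push_cast
    simp only [mul_comm]
  have hQ (k : ℕ) : ∀ (p : ℤ) (r : G), R₁ p (NC + k) r - R₂ p (NC + k) r = 0 := by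
    induction k with
    | zero => simpa using hQ0
    | succ k ih =>
      intro p r
      have h1 := ih (p + 1) r
      have h2 := ih p (r + 1)
      push_cast
      rw [← add_assoc, hR₁rec, hR₂rec,
        sub_sub_sub_comm, h1, h2, sub_zero]
  have hD (p n : ℤ) (r : G) : L (p + 1) n r - (R₁ (p + 1) n r - R₂ (p + 1) n r) =
      (L p (n + 1) r - (R₁ p (n + 1) r - R₂ p (n + 1) r)) +
      (L p n (r + 1) - (R₁ p n (r + 1) - R₂ p n (r + 1))) := by
    rw [hLrec, hR₁rec, hR₂rec]
    abel
  -- For large `n` each side vanishes separately: `L` by truncation of `B`, and `R₁ - R₂` by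
  -- commutativity.
  have hlarge : ∃ N : ℤ, ∀ n ≥ N, ∀ (p : ℤ) (r : G), L p n r - (R₁ p n r - R₂ p n r) = 0 := by
    refine ⟨max NB NC, fun n hn p r => ?_⟩
    have h1 : L p n r = 0 := by
      apply binSum_of_eq_zero
      intro i
      rw [hNB _ (by have := le_max_left NB NC; lia)]
      simp
    have h2 := hQ (n - NC).toNat p r
    rw [show (NC : ℤ) + (n - NC).toNat = n by have := le_max_right NB NC; lia] at h2
    rw [h1, h2, sub_zero]
  have hzero (n : ℤ) (r : G) : L 0 n r - (R₁ 0 n r - R₂ 0 n r) = 0 := by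
    have h := hassoc n r x
    simp only [hL, hR₁, hR₂, binSum_zero]
    rw [sub_eq_zero]
    simp only [Nat.cast_zero, add_zero, Int.cast_zero, zero_add, sub_zero]
    rw [h]
    unfold binSum
    rw [← finsum_sub_distrib]
    · simp only [smul_sub]
    · obtain ⟨N, hN⟩ := eventually_atTop.mp (hA' r)
      refine (Set.finite_lt_nat N).subset fun i hi => ?_
      by_contra hlt
      exact hi (by simp [hN i (by simpa using hlt)])
    · obtain ⟨N, hN⟩ := eventually_atTop.mp (hP' 0)
      simp only [zero_add] at hN
      refine (Set.finite_lt_nat N).subset fun i hi => ?_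
      by_contra hlt
      exact hi (by simp [hN i (by simpa using hlt)])
  have key (p : ℤ) : ∀ (n : ℤ) (r : G), L p n r - (R₁ p n r - R₂ p n r) = 0 := by
    induction p with
    | zero => exact hzero
    | succ q ih =>
      intro n r
      rw [hD, ih, ih, add_zero]
    | pred q ih =>
      obtain ⟨N, hN⟩ := hlarge
      -- Once the case `-q` is known, the recursion says that the defect at `(-q-1, n, r)` is minus
      -- the one at `(-q-1, n+1, r-1)`; descend in `n` from the range where it vanishes.
      have hdown (k : ℕ) : ∀ (n : ℤ), n ≥ N - k → ∀ (r : G),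
          L (-q - 1) n r - (R₁ (-q - 1) n r - R₂ (-q - 1) n r) = 0 := by
        induction k with
        | zero =>
          intro n hn r
          exact hN n (by simpa using hn) _ r
        | succ k ihk =>
          intro n hn r
          have h := hD (-q - 1) n (r - 1)
          rw [sub_add_cancel, sub_add_cancel, ih, ihk (n + 1) (by push_cast at hn; lia),
            zero_add] at h
          exact h.symm
      intro n r
      exact hdown (N - n).toNat n (by lia) r
  exact sub_eq_zero.mp (key p n r)

end Borcherds

/-! ### Projections of an internal direct sum -/

section GradedProj

variable {ι M : Type*} [DecidableEq ι] [AddCommGroup M] [Module ℂ M] {A : ι → Submodule ℂ M}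

theorem gradedProj_of_mem (h : DirectSum.IsInternal A) {i : ι} {x : M} (hx : x ∈ A i) :
    (gradedProj h i x : M) = x := by
  have : (LinearEquiv.ofBijective (DirectSum.coeLinearMap A) h).symm x =
      DirectSum.lof ℂ ι (fun j => A j) i ⟨x, hx⟩ := by
    rw [LinearEquiv.symm_apply_eq]
    exact (DirectSum.coeLinearMap_lof A i ⟨x, hx⟩).symm
  simp only [gradedProj, LinearMap.comp_apply, LinearEquiv.coe_coe, this]
  rw [DirectSum.component.lof_self]

theorem gradedProj_of_mem_of_ne (h : DirectSum.IsInternal A) {i j : ι} {x : M} (hx : x ∈ A i)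
    (hij : i ≠ j) : gradedProj h j x = 0 := by
  have : (LinearEquiv.ofBijective (DirectSum.coeLinearMap A) h).symm x =
      DirectSum.lof ℂ ι (fun j => A j) i ⟨x, hx⟩ := by
    rw [LinearEquiv.symm_apply_eq]
    exact (DirectSum.coeLinearMap_lof A i ⟨x, hx⟩).symm
  simp only [gradedProj, LinearMap.comp_apply, LinearEquiv.coe_coe, this]
  rw [DirectSum.component.of, dif_neg hij]

theorem finite_gradedProj_ne_zero (h : DirectSum.IsInternal A) (x : M) :
    {i | gradedProj h i x ≠ 0}.Finite :=
  DFinsupp.finite_support ((LinearEquiv.ofBijective (DirectSum.coeLinearMap A) h).symm x)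

theorem DirectSum.IsInternal.induction_on (h : DirectSum.IsInternal A) {P : M → Prop}
    (mem : ∀ i, ∀ x ∈ A i, P x) (add : ∀ x y, P x → P y → P (x + y)) (zero : P 0) (x : M) : P x :=
  Submodule.iSup_induction A (motive := P) (x := x)
    (by rw [h.submodule_iSup_eq_top]; trivial) mem zero add

end GradedProj

/-! ### Homogeneous modes -/

section Modes

variable {V M : Type*} [AddCommGroup V] [Module ℂ V] [AddCommGroup M] [Module ℂ M]
  {𝒱 : VertexOperatorAlgebra V}

theorem VOAModule.borcherds (𝓜 : VOAModule 𝒱 M) (u v : V) (p n r : ℤ) (x : M) :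
    binSum p (fun i => 𝓜.Y (𝒱.Y u (n + i) v) (p + r - i) x) =
      binSum n (fun i => (-1 : ℂ) ^ i • 𝓜.Y u (p + n - i) (𝓜.Y v (r + i) x)) -
      binSum n (fun i => (-1 : ℂ) ^ (n + (i : ℤ)) • 𝓜.Y v (n + r - i) (𝓜.Y u (p + i) x)) := by
  refine borcherds_identity (G := ℤ) (B := fun n => 𝓜.Y (𝒱.Y u n v)) ?_ (𝓜.truncation u) ?_
    (𝓜.commutativity u v) (𝓜.associativity u v) p n r x
  · intro r x
    obtain ⟨N, hN⟩ := 𝓜.truncation v x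
    exact ⟨(N - r).toNat, fun n hn => hN _ (by lia)⟩
  · obtain ⟨N, hN⟩ := 𝒱.truncation u v
    exact ⟨N, fun n hn => by rw [hN n hn, map_zero]⟩

/-- The Jacobi identity for `ω` with `p = 1`, `n = 0` reads `[L(0), v(n)] = (L(-1)v)(n+1) +
(L(0)v)(n)`, which equals `(d - n - 1) v(n)` by the derivative property. -/
theorem VOAModule.Y_mem (𝓜 : VOAModule 𝒱 M) {v : V} {x : M} {d : ℤ} {s : ℂ}
    (hv : v ∈ (𝒱.Y 𝒱.ω 1).eigenspace (d : ℂ)) (hx : x ∈ 𝓜.L0.eigenspace s) (n : ℤ) :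
    𝓜.Y v n x ∈ 𝓜.L0.eigenspace (s + d - n - 1) := by
  have h := 𝓜.borcherds 𝒱.ω v 1 0 n x
  rw [Module.End.mem_eigenspace_iff] at hv hx ⊢
  rw [binSum_zero, binSum_zero, show (1 : ℤ) = 0 + 1 by rfl, binSum_add_one, binSum_zero,
    binSum_zero] at h
  · simp only [Nat.cast_zero, add_zero, zero_add, sub_zero, pow_zero, one_smul, zpow_zero,
      Nat.cast_one, hv, 𝓜.derivative] at h
    rw [show (1 + n - 1 : ℤ) = n by ring] at h
    change _ = 𝓜.L0 _ - 𝓜.Y v n (𝓜.L0 x) at h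
    rw [hx, eq_sub_iff_add_eq] at h
    rw [← h]
    simp only [map_smul, LinearMap.smul_apply, Pi.smul_apply, ← add_smul]
    congr 1
    push_cast
    ring
  · obtain ⟨N, hN⟩ := 𝒱.truncation 𝒱.ω v
    filter_upwards [Filter.eventually_ge_atTop N.toNat] with i hi
    rw [hN _ (by lia), map_zero]
    rfl

theorem VOAModule.weightProj_of_mem (𝓜 : VOAModule 𝒱 M) {s : ℂ} {x : M}
    (hx : x ∈ 𝓜.L0.eigenspace s) : (𝓜.weightProj s x : M) = x :=
  gradedProj_of_mem (A := fun h : ℂ => 𝓜.L0.eigenspace h) 𝓜.grading hx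

theorem VOAModule.weightProj_of_mem_of_ne (𝓜 : VOAModule 𝒱 M) {s t : ℂ} {x : M}
    (hx : x ∈ 𝓜.L0.eigenspace s) (hst : s ≠ t) : 𝓜.weightProj t x = 0 :=
  gradedProj_of_mem_of_ne (A := fun h : ℂ => 𝓜.L0.eigenspace h) 𝓜.grading hx hst

theorem VOAModule.finite_weightProj_ne_zero (𝓜 : VOAModule 𝒱 M) (x : M) :
    {s | 𝓜.weightProj s x ≠ 0}.Finite :=
  finite_gradedProj_ne_zero (A := fun h : ℂ => 𝓜.L0.eigenspace h) 𝓜.grading x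

/-! ### Linearity of the square bracket modes -/

/-- `Res_x Y(v, x) (log(1+x))^m (1+x)^{d-1} u`, whatever the weight of `v`. -/
def VOAModule.residue (𝓜 : VOAModule 𝒱 M) (d m : ℤ) (v : V) (u : M) : M :=
  ∑ᶠ i : ℤ, bracketCoeff d m i • 𝓜.Y v i u

theorem VOAModule.finite_support_residue (𝓜 : VOAModule 𝒱 M) (d m : ℤ) (v : V) (u : M) :
    (Function.support fun i : ℤ => bracketCoeff d m i • 𝓜.Y v i u).Finite := by
  obtain ⟨N, hN⟩ := 𝓜.truncation v u
  refine (Set.finite_Ico m N).subset fun i hi => ?_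
  rw [Set.mem_Ico]
  by_contra! h
  apply hi
  by_cases hm : m ≤ i
  · simp [hN i (h hm)]
  · simp [bracketCoeff_eq_zero d m i (by lia)]

theorem VOAModule.residue_add_left (𝓜 : VOAModule 𝒱 M) (d m : ℤ) (v w : V) (u : M) :
    𝓜.residue d m (v + w) u = 𝓜.residue d m v u + 𝓜.residue d m w u := by
  unfold residue
  rw [← finsum_add_distrib (𝓜.finite_support_residue d m v u) (𝓜.finite_support_residue d m w u)]
  simp [smul_add]

theorem VOAModule.residue_add_right (𝓜 : VOAModule 𝒱 M) (d m : ℤ) (v : V) (u w : M) :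
    𝓜.residue d m v (u + w) = 𝓜.residue d m v u + 𝓜.residue d m v w := by
  unfold residue
  rw [← finsum_add_distrib (𝓜.finite_support_residue d m v u) (𝓜.finite_support_residue d m v w)]
  simp [smul_add]

theorem VOAModule.residue_zero_left (𝓜 : VOAModule 𝒱 M) (d m : ℤ) (u : M) :
    𝓜.residue d m 0 u = 0 := by
  simp [residue]

theorem VOAModule.residue_zero_right (𝓜 : VOAModule 𝒱 M) (d m : ℤ) (v : V) :
    𝓜.residue d m v 0 = 0 := by
  simp [residue]

theorem VOAModule.bracket_eq_finsum_residue (𝓜 : VOAModule 𝒱 M) (a : V) (m : ℤ) (u : M) :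
    𝓜.bracket a m u = ∑ᶠ d : ℤ, 𝓜.residue d m (𝒱.weightProj d a : V) u :=
  rfl

theorem VOAModule.finite_support_bracket (𝓜 : VOAModule 𝒱 M) (a : V) (m : ℤ) (u : M) :
    (Function.support fun d : ℤ => 𝓜.residue d m (𝒱.weightProj d a : V) u).Finite := by
  refine (finite_gradedProj_ne_zero 𝒱.grading a).subset fun d hd h0 => hd ?_
  change 𝒱.weightProj d a = 0 at h0
  simp [h0, residue_zero_left]

theorem VOAModule.bracket_add_left (𝓜 : VOAModule 𝒱 M) (a b : V) (m : ℤ) (u : M) :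
    𝓜.bracket (a + b) m u = 𝓜.bracket a m u + 𝓜.bracket b m u := by
  simp only [bracket_eq_finsum_residue]
  rw [← finsum_add_distrib (𝓜.finite_support_bracket a m u) (𝓜.finite_support_bracket b m u)]
  simp [residue_add_left]

theorem VOAModule.bracket_add_right (𝓜 : VOAModule 𝒱 M) (a : V) (m : ℤ) (u v : M) :
    𝓜.bracket a m (u + v) = 𝓜.bracket a m u + 𝓜.bracket a m v := by
  simp only [bracket_eq_finsum_residue]
  rw [← finsum_add_distrib (𝓜.finite_support_bracket a m u) (𝓜.finite_support_bracket a m v)]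
  simp [residue_add_right]

theorem VOAModule.bracket_zero_left (𝓜 : VOAModule 𝒱 M) (m : ℤ) (u : M) :
    𝓜.bracket 0 m u = 0 := by
  simp [bracket_eq_finsum_residue, residue_zero_left]

theorem VOAModule.bracket_zero_right (𝓜 : VOAModule 𝒱 M) (a : V) (m : ℤ) :
    𝓜.bracket a m 0 = 0 := by
  simp [bracket_eq_finsum_residue, residue_zero_right]

theorem VOAModule.bracket_of_mem (𝓜 : VOAModule 𝒱 M) {a : V} {d : ℤ}
    (ha : a ∈ (𝒱.Y 𝒱.ω 1).eigenspace (d : ℂ)) (m : ℤ) (u : M) :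
    𝓜.bracket a m u = 𝓜.residue d m a u := by
  rw [bracket_eq_finsum_residue, finsum_eq_single _ d]
  · rw [show (𝒱.weightProj d a : V) = a from gradedProj_of_mem 𝒱.grading ha]
  · intro e he
    rw [show 𝒱.weightProj e a = 0 from gradedProj_of_mem_of_ne 𝒱.grading ha he.symm]
    simp [residue_zero_left]

/-- `a[m]u` as a finite sum, when `m ≥ l` and `a(i)u = 0` for `i ≥ l + N`. -/
theorem VOAModule.bracket_eq_sum (𝓜 : VOAModule 𝒱 M) {a : V} {d : ℤ}
    (ha : a ∈ (𝒱.Y 𝒱.ω 1).eigenspace (d : ℂ)) (l m : ℤ) (hm : l ≤ m) (u : M) (N : ℕ)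
    (hN : ∀ i ≥ l + N, 𝓜.Y a i u = 0) :
    𝓜.bracket a m u = ∑ j ∈ Finset.range N, bracketCoeff d m (l + j) • 𝓜.Y a (l + j) u := by
  have hinj : Function.Injective fun j : ℕ => l + (j : ℤ) := fun i j h => by simpa using h
  rw [𝓜.bracket_of_mem ha, residue,
    finsum_eq_sum_of_support_subset (s := (Finset.range N).map ⟨_, hinj⟩), Finset.sum_map]
  · rfl
  · intro i hi
    simp only [Finset.coe_map, Function.Embedding.coeFn_mk, Set.mem_image, Finset.mem_coe,
      Finset.mem_range]
    by_contra hc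
    apply hi
    by_cases h1 : i < m
    · simp [bracketCoeff_eq_zero d m i h1]
    · have h2 : l + N ≤ i := by
        by_contra h3
        exact hc ⟨(i - l).toNat, by lia, by lia⟩
      simp [hN i h2]

end Modes

/-! ### Jacobi identity and weights for intertwining operators. -/

section Intertwining

variable {V U W : Type*} [AddCommGroup V] [Module ℂ V] [AddCommGroup U] [Module ℂ U]
  [AddCommGroup W] [Module ℂ W] {𝒱 : VertexOperatorAlgebra V}
  {𝓤 : VOAModule 𝒱 U} {𝓦 : VOAModule 𝒱 W}

theorem IntertwiningOperator.borcherds (I : IntertwiningOperator 𝓤 𝓦 𝓦) (v : V) (u : U)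
    (p n : ℤ) (r : ℂ) (x : W) :
    binSum p (fun i => I.I (𝓤.Y v (n + i) u) (p + r - i) x) =
      binSum n (fun i => (-1 : ℂ) ^ i • 𝓦.Y v (p + n - i) (I.I u (r + i) x)) -
      binSum n (fun i => (-1 : ℂ) ^ (n + (i : ℤ)) • I.I u (n + r - i) (𝓦.Y v (p + i) x)) := by
  refine borcherds_identity (G := ℂ) (B := fun n => I.I (𝓤.Y v n u)) ?_ (𝓦.truncation v) ?_
    (I.commutativity v u) (I.associativity v u) p n r x
  · intro r x
    exact I.truncation u x r
  · obtain ⟨N, hN⟩ := 𝓤.truncation v u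
    exact ⟨N, fun n hn => by rw [hN n hn, map_zero]⟩

theorem IntertwiningOperator.I_mem (I : IntertwiningOperator 𝓤 𝓦 𝓦) {u : U} {x : W} {h s : ℂ}
    (hu : u ∈ 𝓤.L0.eigenspace h) (hx : x ∈ 𝓦.L0.eigenspace s) (r : ℂ) :
    I.I u r x ∈ 𝓦.L0.eigenspace (s + h - r - 1) := by
  have hb := I.borcherds 𝒱.ω u 1 0 r x
  rw [Module.End.mem_eigenspace_iff] at hu hx ⊢
  rw [binSum_zero, binSum_zero, show (1 : ℤ) = 0 + 1 by rfl, binSum_add_one, binSum_zero,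
    binSum_zero] at hb
  · simp only [Nat.cast_zero, add_zero, zero_add, sub_zero, pow_zero, one_smul, zpow_zero,
      Nat.cast_one, Int.cast_one, Int.cast_zero] at hb
    change I.I (𝓤.Lneg1 u) (1 + r) x + I.I (𝓤.L0 u) _ x =
      𝓦.L0 _ - I.I u r (𝓦.L0 x) at hb
    rw [hx, eq_sub_iff_add_eq, hu, I.derivative, add_sub_cancel_left] at hb
    rw [← hb]
    simp only [map_smul, LinearMap.smul_apply, Pi.smul_apply, ← add_smul]
    congr 1
    ring
  · obtain ⟨N, hN⟩ := 𝓤.truncation 𝒱.ω u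
    filter_upwards [Filter.eventually_ge_atTop N.toNat] with i hi
    rw [hN _ (by lia), map_zero]
    rfl

/-! ### The operators `o(u)` -/

theorem IntertwiningOperator.finite_support_o (I : IntertwiningOperator 𝓤 𝓦 𝓦) (u : U) :
    (Function.support fun h : ℂ => I.I (𝓤.weightProj h u : U) (h - 1)).Finite := by
  refine (𝓤.finite_weightProj_ne_zero u).subset fun h hh h0 => hh ?_
  simp [h0]

theorem IntertwiningOperator.o_add (I : IntertwiningOperator 𝓤 𝓦 𝓦) (u v : U) :
    I.o (u + v) = I.o u + I.o v := by
  unfold o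
  rw [← finsum_add_distrib (I.finite_support_o u) (I.finite_support_o v)]
  simp

theorem IntertwiningOperator.o_smul (I : IntertwiningOperator 𝓤 𝓦 𝓦) (c : ℂ) (u : U) :
    I.o (c • u) = c • I.o u := by
  unfold o
  rw [smul_finsum]
  simp

/-- `u ↦ o(u)` as a linear map. -/
def IntertwiningOperator.oLinear (I : IntertwiningOperator 𝓤 𝓦 𝓦) : U →ₗ[ℂ] Module.End ℂ W where
  toFun := I.o
  map_add' := I.o_add
  map_smul' := I.o_smul

theorem IntertwiningOperator.oLinear_of_mem (I : IntertwiningOperator 𝓤 𝓦 𝓦) {u : U} {h : ℂ}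
    (hu : u ∈ 𝓤.L0.eigenspace h) : I.oLinear u = I.I u (h - 1) := by
  change I.o u = _
  unfold o
  rw [finsum_eq_single _ h]
  · rw [𝓤.weightProj_of_mem hu]
  · intro t ht
    simp [𝓤.weightProj_of_mem_of_ne hu ht.symm]

end Intertwining

/-! ### Traces on the homogeneous subspaces -/

section GradedTrace

variable {V M : Type*} [AddCommGroup V] [Module ℂ V] [AddCommGroup M] [Module ℂ M]
  {𝒱 : VertexOperatorAlgebra V}

/-- The trace of the block `M_s → M_s` of an operator. -/
def VOAModule.gradedTrace (𝓜 : VOAModule 𝒱 M) (s : ℂ) : Module.End ℂ M →ₗ[ℂ] ℂ where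
  toFun A := LinearMap.trace ℂ (𝓜.L0.eigenspace s)
    (𝓜.weightProj s ∘ₗ A ∘ₗ (𝓜.L0.eigenspace s).subtype)
  map_add' A B := by
    rw [LinearMap.add_comp, LinearMap.comp_add, map_add]
  map_smul' c A := by
    rw [LinearMap.smul_comp, LinearMap.comp_smul, map_smul, RingHom.id_apply]

theorem VOAModule.gradedTrace_apply (𝓜 : VOAModule 𝒱 M) (s : ℂ) (A : Module.End ℂ M) :
    𝓜.gradedTrace s A = LinearMap.trace ℂ (𝓜.L0.eigenspace s)
      (𝓜.weightProj s ∘ₗ A ∘ₗ (𝓜.L0.eigenspace s).subtype) :=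
  rfl

theorem VOAModule.gradedTrace_congr (𝓜 : VOAModule 𝒱 M) {s : ℂ} {A B : Module.End ℂ M}
    (h : ∀ x ∈ 𝓜.L0.eigenspace s, A x = B x) : 𝓜.gradedTrace s A = 𝓜.gradedTrace s B := by
  rw [gradedTrace_apply, gradedTrace_apply]
  congr 1
  ext x
  simp [h x x.2]

theorem VOAModule.gradedTrace_of_eq_bot (𝓜 : VOAModule 𝒱 M) {s : ℂ} (hs : 𝓜.L0.eigenspace s = ⊥)
    (A : Module.End ℂ M) : 𝓜.gradedTrace s A = 0 := by
  rw [𝓜.gradedTrace_congr (B := 0), map_zero]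
  intro x hx
  rw [hs, Submodule.mem_bot] at hx
  simp [hx]

/-- Cyclicity between two different weight spaces: since `A` maps `M_s` into `M_t`, a projection
onto `M_t` can be inserted between the factors, leaving maps of finite dimensional spaces. -/
theorem VOAModule.gradedTrace_mul_comm (𝓜 : VOAModule 𝒱 M) {s t : ℂ} {A B : Module.End ℂ M}
    (hA : ∀ x ∈ 𝓜.L0.eigenspace s, A x ∈ 𝓜.L0.eigenspace t)
    (hB : ∀ x ∈ 𝓜.L0.eigenspace t, B x ∈ 𝓜.L0.eigenspace s) :
    𝓜.gradedTrace s (B * A) = 𝓜.gradedTrace t (A * B) := by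
  have : FiniteDimensional ℂ (𝓜.L0.eigenspace s) := 𝓜.finiteDimensional s
  have : FiniteDimensional ℂ (𝓜.L0.eigenspace t) := 𝓜.finiteDimensional t
  have key {s t : ℂ} {A B : Module.End ℂ M}
      (hA : ∀ x ∈ 𝓜.L0.eigenspace s, A x ∈ 𝓜.L0.eigenspace t) :
      𝓜.weightProj s ∘ₗ (B * A) ∘ₗ (𝓜.L0.eigenspace s).subtype =
        (𝓜.weightProj s ∘ₗ B ∘ₗ (𝓜.L0.eigenspace t).subtype) ∘ₗ
        (𝓜.weightProj t ∘ₗ A ∘ₗ (𝓜.L0.eigenspace s).subtype) := by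
    ext x
    simp [𝓜.weightProj_of_mem (hA x x.2)]
  rw [gradedTrace_apply, gradedTrace_apply, key hA, key hB, LinearMap.trace_comp_comm']

theorem VOAModule.exists_eigenspace_eq_bot (𝓜 : VOAModule 𝒱 M) (s : ℂ) :
    ∃ N : ℕ, ∀ n ≥ N, 𝓜.L0.eigenspace (s - (n : ℂ)) = ⊥ :=
  𝓜.lowerBound s

end GradedTrace

/-! ### Commutators of modes and the recursion for their traces. -/

section TraceRecursion

variable {V U W : Type*} [AddCommGroup V] [Module ℂ V] [AddCommGroup U] [Module ℂ U]
  [AddCommGroup W] [Module ℂ W] {𝒱 : VertexOperatorAlgebra V}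
  {𝓤 : VOAModule 𝒱 U} {𝓦 : VOAModule 𝒱 W}

theorem IntertwiningOperator.trace_eq_gradedTrace (I : IntertwiningOperator 𝓤 𝓦 𝓦) (u : U)
    (s : ℂ) : I.trace u s = 𝓦.gradedTrace s (I.oLinear u) :=
  rfl

theorem IntertwiningOperator.trace_add (I : IntertwiningOperator 𝓤 𝓦 𝓦) (u v : U) :
    I.trace (u + v) = I.trace u + I.trace v := by
  ext s
  simp [trace_eq_gradedTrace]

theorem IntertwiningOperator.trace_zero (I : IntertwiningOperator 𝓤 𝓦 𝓦) : I.trace 0 = 0 := by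
  ext s
  simp [trace_eq_gradedTrace]

theorem IntertwiningOperator.trace_of_eq_bot (I : IntertwiningOperator 𝓤 𝓦 𝓦) (u : U) {s : ℂ}
    (hs : 𝓦.L0.eigenspace s = ⊥) : I.trace u s = 0 :=
  𝓦.gradedTrace_of_eq_bot hs _

/-- For homogeneous `a`, `u`: `[a(wt a - 1 + n), u(wt u - 1 - n)] = ∑_k n^k/k! o(a[k]u)`. -/
theorem IntertwiningOperator.commutator_modes (I : IntertwiningOperator 𝓤 𝓦 𝓦) {a : V} {d : ℤ}
    (ha : a ∈ (𝒱.Y 𝒱.ω 1).eigenspace (d : ℂ)) {u : U} {h : ℂ} (hu : u ∈ 𝓤.L0.eigenspace h)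
    (n : ℤ) (K : ℕ) (hK : ∀ i ≥ (K : ℤ), 𝓤.Y a i u = 0) :
    𝓦.Y a (d - 1 + n) * I.I u (h - 1 - n) - I.I u (h - 1 - n) * 𝓦.Y a (d - 1 + n) =
      ∑ k ∈ Finset.range K, ((n : ℂ) ^ k / (k.factorial : ℂ)) •
        I.oLinear (𝓤.bracket a k u) := by
  have hbr (k : ℕ) : 𝓤.bracket a k u =
      ∑ i ∈ Finset.range K, bracketCoeff d k i • 𝓤.Y a i u := by
    have := 𝓤.bracket_eq_sum ha 0 k (by lia) u K (by simpa using hK)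
    simpa using this
  have ho (i : ℕ) : I.oLinear (𝓤.Y a i u) =
      I.I (𝓤.Y a i u) ((d - 1 + n : ℤ) + (h - 1 - n) - i) := by
    rw [I.oLinear_of_mem (𝓤.Y_mem ha hu i)]
    refine congrArg (I.I _) ?_
    push_cast
    ring
  have hsum : ∑ k ∈ Finset.range K, ((n : ℂ) ^ k / (k.factorial : ℂ)) •
        I.oLinear (𝓤.bracket a k u) =
      ∑ i ∈ Finset.range K, ((Ring.choose (d - 1 + n) i : ℤ) : ℂ) •
        I.I (𝓤.Y a i u) ((d - 1 + n : ℤ) + (h - 1 - n) - i) := by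
    simp only [hbr, map_sum, map_smul, Finset.smul_sum, smul_smul]
    rw [Finset.sum_comm]
    refine Finset.sum_congr rfl fun i hi => ?_
    rw [← Finset.sum_smul, sum_pow_mul_bracketCoeff d n i K (Finset.mem_range.mp hi), ho,
      show n + d - 1 = d - 1 + n by ring]
  rw [hsum]
  ext x
  -- For exponent `0` the Jacobi identity is the commutator formula.
  have hb := I.borcherds a u (d - 1 + n) 0 (h - 1 - n) x
  rw [binSum_zero, binSum_zero, binSum_eq_sum_range _ _ K] at hb
  · simp only [Nat.cast_zero, add_zero, zero_add, sub_zero, pow_zero, one_smul, zpow_zero,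
      Int.cast_zero] at hb
    rw [LinearMap.sub_apply, Module.End.mul_apply, Module.End.mul_apply, ← hb,
      LinearMap.sum_apply]
    rfl
  · intro i hi
    rw [hK _ (by lia), map_zero]
    rfl

/-- For homogeneous `a`, `u`, with `X = Res_x x^{-2}(1+x)^{wt a} Y(a, x) u`, on `W_s`:
`o(X) = ∑_{m ≥ 1} m (a(wt a-1-m) u(wt u-1+m) - u(wt u-1-m) a(wt a-1+m))`. -/
theorem IntertwiningOperator.o_residue_modes (I : IntertwiningOperator 𝓤 𝓦 𝓦) {a : V} {d : ℤ}
    (ha : a ∈ (𝒱.Y 𝒱.ω 1).eigenspace (d : ℂ)) {u : U} {h : ℂ} (hu : u ∈ 𝓤.L0.eigenspace h)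
    (J : ℕ) (hJ : ∀ i ≥ (J : ℤ), 𝓤.Y a (-2 + i) u = 0)
    {s : ℂ} (N : ℕ) (hN : ∀ n ≥ N, 𝓦.L0.eigenspace (s - (n : ℂ)) = ⊥)
    {x : W} (hx : x ∈ 𝓦.L0.eigenspace s) :
    I.oLinear (∑ j ∈ Finset.range J, ((Ring.choose d j : ℤ) : ℂ) • 𝓤.Y a (-2 + j) u) x =
      ∑ i ∈ Finset.range N, ((i : ℂ) + 1) •
        ((𝓦.Y a (d - 2 - i) * I.I u (h + i)) x - (I.I u (h - 2 - i) * 𝓦.Y a (d + i)) x) := by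
  -- `p = d` supplies `(1+x)^d` and the exponent `-2` supplies `x^{-2}`; the coefficients `m = i +
  -- 1` come from expanding `(1-t)^{-2}`.
  have hb := I.borcherds a u d (-2) h x
  have ho (i : ℕ) : I.oLinear (𝓤.Y a (-2 + i) u) = I.I (𝓤.Y a (-2 + i) u) (d + h - i) := by
    rw [I.oLinear_of_mem (𝓤.Y_mem ha hu _)]
    refine congrArg (I.I _) ?_
    push_cast
    ring
  have hbot {y : W} {i : ℕ} (hi : i ≥ N) (hy : y ∈ 𝓦.L0.eigenspace (s - (i + 1 : ℕ))) : y = 0 := by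
    rw [hN _ (by lia)] at hy
    simpa using hy
  -- The right-hand mode of each product lowers the weight by `i + 1`, so it kills `x` once `i ≥ N`.
  have hz1 (i : ℕ) (hi : i ≥ N) : I.I u (h + i) x = 0 := by
    refine hbot hi ?_
    have := I.I_mem hu hx (h + i)
    convert! this using 2
    push_cast
    ring
  have hz2 (i : ℕ) (hi : i ≥ N) : 𝓦.Y a (d + i) x = 0 := by
    refine hbot hi ?_
    have := 𝓦.Y_mem ha hx (d + i)
    convert! this using 2
    push_cast
    ring
  have hc (i : ℕ) : ((Ring.choose (-2 : ℤ) i : ℤ) : ℂ) * (-1) ^ i = (i : ℂ) + 1 := by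
    rw [Ring.choose_neg, show (2 : ℤ) + i - 1 = ((i + 1 : ℕ) : ℤ) by push_cast; ring,
      Ring.choose_natCast, Nat.choose_succ_self_right, Units.smul_def, smul_eq_mul, Int.cast_mul,
      Int.cast_negOnePow_natCast, mul_right_comm, ← mul_pow]
    simp
  have hc' (i : ℕ) : (-1 : ℂ) ^ (-2 + (i : ℤ)) = (-1) ^ i := by
    rw [zpow_add₀ (by simp)]
    simp
  rw [binSum_eq_sum_range _ _ J, binSum_eq_sum_range _ _ N, binSum_eq_sum_range _ _ N,
    ← Finset.sum_sub_distrib] at hb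
  · rw [map_sum, LinearMap.sum_apply]
    simp only [map_smul, ho]
    refine hb.trans (Finset.sum_congr rfl fun i _ => ?_)
    rw [hc', smul_smul, smul_smul, hc, ← smul_sub, Module.End.mul_apply, Module.End.mul_apply]
    rw [show d + -2 - (i : ℤ) = d - 2 - i by ring,
      show ((-2 : ℤ) : ℂ) + h - i = h - 2 - i by push_cast; ring]
  · intro i hi
    rw [hz2 i hi]
    simp
  · intro i hi
    rw [hz1 i hi]
    simp
  · intro i hi
    rw [hJ _ (by lia), map_zero]
    rfl

/-- On generating series the hypothesis is `(1 - q^m) F = q^m C`; this is the partial expansion of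
`q^m/(1-q^m)`. -/
theorem eq_sum_of_shift_recursion {F C : ℂ → ℂ} (m : ℂ) (h : ∀ s, F s = F (s - m) + C (s - m))
    (N : ℕ) (s : ℂ) : F s = F (s - N * m) + ∑ j ∈ Finset.range N, C (s - (j + 1) * m) := by
  induction N with
  | zero => simp
  | succ N ih =>
    rw [ih, h (s - N * m), Finset.sum_range_succ, show s - N * m - m = s - (N + 1) * m by ring]
    push_cast
    ring

/-- The trace of `a(wt a-1-m) u(wt u-1+m)` for `m > 0`. -/
theorem IntertwiningOperator.gradedTrace_Y_mul_I (I : IntertwiningOperator 𝓤 𝓦 𝓦) {a : V} {d : ℤ}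
    (ha : a ∈ (𝒱.Y 𝒱.ω 1).eigenspace (d : ℂ)) {u : U} {h : ℂ} (hu : u ∈ 𝓤.L0.eigenspace h)
    (K : ℕ) (hK : ∀ i ≥ (K : ℤ), 𝓤.Y a i u = 0) (m : ℕ)
    {s : ℂ} (N : ℕ) (hN : ∀ n ≥ N, 𝓦.L0.eigenspace (s - (n : ℂ)) = ⊥) :
    𝓦.gradedTrace s (𝓦.Y a (d - 2 - m) * I.I u (h + m)) =
      -∑ j ∈ Finset.range N, ∑ k ∈ Finset.range K, (-((m : ℂ) + 1)) ^ k / (k.factorial : ℂ) *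
        I.trace (𝓤.bracket a k u) (s - (j + 1) * (m + 1)) := by
  -- The mode of `u` lowers the weight by `m + 1`, so cyclicity carries the trace to weight `t -
  -- (m+1)` with the factors exchanged; restoring their order subtracts the commutator with `n =
  -- -(m+1)`.
  have hrec (t : ℂ) : 𝓦.gradedTrace t (𝓦.Y a (d - 2 - m) * I.I u (h + m)) =
      𝓦.gradedTrace (t - (m + 1)) (𝓦.Y a (d - 2 - m) * I.I u (h + m)) +
      -∑ k ∈ Finset.range K, (-((m : ℂ) + 1)) ^ k / (k.factorial : ℂ) *
        I.trace (𝓤.bracket a k u) (t - (m + 1)) := by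
    have hcomm := I.commutator_modes ha hu (-(m + 1)) K hK
    rw [show d - 1 + -((m : ℤ) + 1) = d - 2 - m by ring,
      show h - 1 - ((-((m : ℤ) + 1) : ℤ) : ℂ) = h + m by push_cast; ring] at hcomm
    have htr := congrArg (𝓦.gradedTrace (t - (m + 1))) hcomm
    rw [map_sub, map_sum] at htr
    simp only [map_smul, smul_eq_mul, ← trace_eq_gradedTrace] at htr
    push_cast at htr
    rw [𝓦.gradedTrace_mul_comm (t := t - (m + 1)), ← htr]
    · ring
    · intro x hx
      have := I.I_mem hu hx (h + m)
      convert! this using 2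
      ring
    · intro x hx
      have := 𝓦.Y_mem ha hx (d - 2 - m)
      convert! this using 2
      push_cast
      ring
  rw [eq_sum_of_shift_recursion
      (F := fun t => 𝓦.gradedTrace t (𝓦.Y a (d - 2 - m) * I.I u (h + m)))
      (C := fun t => -∑ k ∈ Finset.range K, (-((m : ℂ) + 1)) ^ k / (k.factorial : ℂ) *
        I.trace (𝓤.bracket a k u) t) ((m : ℂ) + 1) hrec N s, Finset.sum_neg_distrib,
    show s - N * ((m : ℂ) + 1) = s - ((N * (m + 1) : ℕ) : ℂ) by push_cast; ring,
    𝓦.gradedTrace_of_eq_bot (hN _ (by nlinarith)), zero_add]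

/-- The trace of `u(wt u-1-m) a(wt a-1+m)` for `m > 0`. -/
theorem IntertwiningOperator.gradedTrace_I_mul_Y (I : IntertwiningOperator 𝓤 𝓦 𝓦) {a : V} {d : ℤ}
    (ha : a ∈ (𝒱.Y 𝒱.ω 1).eigenspace (d : ℂ)) {u : U} {h : ℂ} (hu : u ∈ 𝓤.L0.eigenspace h)
    (K : ℕ) (hK : ∀ i ≥ (K : ℤ), 𝓤.Y a i u = 0) (m : ℕ)
    {s : ℂ} (N : ℕ) (hN : ∀ n ≥ N, 𝓦.L0.eigenspace (s - (n : ℂ)) = ⊥) :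
    𝓦.gradedTrace s (I.I u (h - 2 - m) * 𝓦.Y a (d + m)) =
      ∑ j ∈ Finset.range N, ∑ k ∈ Finset.range K, ((m : ℂ) + 1) ^ k / (k.factorial : ℂ) *
        I.trace (𝓤.bracket a k u) (s - (j + 1) * (m + 1)) := by
  have hrec (t : ℂ) : 𝓦.gradedTrace t (I.I u (h - 2 - m) * 𝓦.Y a (d + m)) =
      𝓦.gradedTrace (t - (m + 1)) (I.I u (h - 2 - m) * 𝓦.Y a (d + m)) +
      ∑ k ∈ Finset.range K, ((m : ℂ) + 1) ^ k / (k.factorial : ℂ) *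
        I.trace (𝓤.bracket a k u) (t - (m + 1)) := by
    have hcomm := I.commutator_modes ha hu (m + 1) K hK
    rw [show d - 1 + ((m : ℤ) + 1) = d + m by ring,
      show h - 1 - (((m : ℤ) + 1 : ℤ) : ℂ) = h - 2 - m by push_cast; ring] at hcomm
    have htr := congrArg (𝓦.gradedTrace (t - (m + 1))) hcomm
    rw [map_sub, map_sum] at htr
    simp only [map_smul, smul_eq_mul, ← trace_eq_gradedTrace] at htr
    push_cast at htr
    rw [𝓦.gradedTrace_mul_comm (t := t - (m + 1)), ← htr]
    · ring
    · intro x hx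
      have := 𝓦.Y_mem ha hx (d + m)
      convert! this using 2
      push_cast
      ring
    · intro x hx
      have := I.I_mem hu hx (h - 2 - m)
      convert! this using 2
      ring
  rw [eq_sum_of_shift_recursion
      (F := fun t => 𝓦.gradedTrace t (I.I u (h - 2 - m) * 𝓦.Y a (d + m)))
      (C := fun t => ∑ k ∈ Finset.range K, ((m : ℂ) + 1) ^ k / (k.factorial : ℂ) *
        I.trace (𝓤.bracket a k u) t) ((m : ℂ) + 1) hrec N s,
    show s - N * ((m : ℂ) + 1) = s - ((N * (m + 1) : ℕ) : ℂ) by push_cast; ring,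
    𝓦.gradedTrace_of_eq_bot (hN _ (by nlinarith)), zero_add]

/-- For `n = 0` both modes preserve `W_s`, and `0^k` leaves only the `k = 0` term of the commutator
formula, so `o(a[0]u)` is a commutator on `W_s`. -/
theorem IntertwiningOperator.trace_bracket_zero_of_mem (I : IntertwiningOperator 𝓤 𝓦 𝓦) {a : V}
    {d : ℤ} (ha : a ∈ (𝒱.Y 𝒱.ω 1).eigenspace (d : ℂ)) {u : U} {h : ℂ}
    (hu : u ∈ 𝓤.L0.eigenspace h) : I.trace (𝓤.bracket a 0 u) = 0 := by
  ext s
  obtain ⟨N, hN⟩ := 𝓤.truncation a u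
  have hcomm := I.commutator_modes ha hu 0 (N.toNat + 1) fun i hi => hN i (by lia)
  have htr := congrArg (𝓦.gradedTrace s) hcomm
  rw [map_sub, map_sum, Finset.sum_range_succ'] at htr
  simp only [map_smul, smul_eq_mul, ← trace_eq_gradedTrace] at htr
  rw [𝓦.gradedTrace_mul_comm (t := s), sub_self] at htr
  · simpa using htr.symm
  · intro x hx
    have := I.I_mem hu hx (h - 1 - (0 : ℤ))
    convert! this using 2
    push_cast
    ring
  · intro x hx
    have := 𝓦.Y_mem ha hx (d - 1 + 0)
    convert! this using 2
    push_cast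
    ring

end TraceRecursion

/-! ### Divisor sums and the trace identity for homogeneous vectors. -/

section TraceIdentity

/-- This is `∑ m^p q^m/(1-q^m) = ∑ σ_p(n) q^n` coefficientwise, sorting pairs by `n = (i+1)(j+1)`.
The cutoffs lose nothing: factors of `n < N` are at most `n`, and products `≥ N` meet zeros of `T`.
-/
theorem sum_sum_pow_mul_eq_sum_divisors (T : ℂ → ℂ) (s : ℂ) (N p : ℕ)
    (hT : ∀ n ≥ N, T (s - (n : ℂ)) = 0) :
    ∑ i ∈ Finset.range N, ∑ j ∈ Finset.range N,
        ((i : ℂ) + 1) ^ p * T (s - ((j : ℂ) + 1) * ((i : ℂ) + 1)) =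
      ∑ n ∈ Finset.Ico 1 N, (∑ d ∈ n.divisors, (d : ℂ) ^ p) * T (s - (n : ℂ)) := by
  have hdiv (n : ℕ) (hn : n ∈ Finset.Ico 1 N) : ∑ d ∈ n.divisors, (d : ℂ) ^ p =
      ∑ i ∈ Finset.range N, ∑ j ∈ Finset.range N,
        if (i + 1) * (j + 1) = n then ((i : ℂ) + 1) ^ p else 0 := by
    rw [Finset.mem_Ico] at hn
    have hd := Nat.sum_divisorsAntidiagonal (n := n) (fun d _ => (d : ℂ) ^ p)
    rw [← hd, ← Finset.sum_product', ← Finset.sum_filter]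
    symm
    refine Finset.sum_bij (fun q _ => (q.1 + 1, q.2 + 1)) ?_ ?_ ?_ ?_
    · intro q hq
      simp only [Finset.mem_filter] at hq
      simp [hq.2]
      lia
    · intro q _ q' _ hqq
      ext <;> simp_all
    · intro q hq
      rw [Nat.mem_divisorsAntidiagonal] at hq
      obtain ⟨q1, q2⟩ := q
      simp only at hq
      have h1 : 0 < q1 := Nat.pos_of_ne_zero fun h => by simp [h] at hq; lia
      have h2 : 0 < q2 := Nat.pos_of_ne_zero fun h => by simp [h] at hq; lia
      refine ⟨(q1 - 1, q2 - 1), ?_, ?_⟩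
      · simp only [Finset.mem_filter, Finset.mem_product, Finset.mem_range]
        rw [Nat.sub_add_cancel h1, Nat.sub_add_cancel h2]
        refine ⟨⟨?_, ?_⟩, hq.1⟩
        · nlinarith [Nat.sub_add_cancel h1]
        · nlinarith [Nat.sub_add_cancel h2]
      · simp only [Prod.mk.injEq]
        lia
    · intro q _
      push_cast
      rfl
  have hR : ∑ n ∈ Finset.Ico 1 N, (∑ d ∈ n.divisors, (d : ℂ) ^ p) * T (s - (n : ℂ)) =
      ∑ n ∈ Finset.Ico 1 N, ∑ i ∈ Finset.range N, ∑ j ∈ Finset.range N,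
        (if (i + 1) * (j + 1) = n then ((i : ℂ) + 1) ^ p else 0) * T (s - (n : ℂ)) := by
    refine Finset.sum_congr rfl fun n hn => ?_
    rw [hdiv n hn]
    simp only [Finset.sum_mul]
  rw [hR]
  conv_rhs => rw [Finset.sum_comm]
  refine Finset.sum_congr rfl fun i _ => ?_
  conv_rhs => rw [Finset.sum_comm]
  refine Finset.sum_congr rfl fun j _ => ?_
  have hcast : ((j : ℂ) + 1) * ((i : ℂ) + 1) = (((i + 1) * (j + 1) : ℕ) : ℂ) := by
    push_cast
    ring
  rw [hcast]
  simp only [ite_mul, zero_mul]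
  rw [Finset.sum_ite_eq]
  split_ifs with h
  · rfl
  · rw [hT _ (by rw [Finset.mem_Ico] at h; by_contra hc; exact h ⟨by nlinarith, by lia⟩), mul_zero]

variable {V U W : Type*} [AddCommGroup V] [Module ℂ V] [AddCommGroup U] [Module ℂ U]
  [AddCommGroup W] [Module ℂ W] {𝒱 : VertexOperatorAlgebra V}
  {𝓤 : VOAModule 𝒱 U} {𝓦 : VOAModule 𝒱 W}

/-- The trace of `o(X)`, `X = Res_x x^{-2}(1+x)^{wt a} Y(a, x) u`. -/
theorem IntertwiningOperator.trace_residue (I : IntertwiningOperator 𝓤 𝓦 𝓦) {a : V} {d : ℤ}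
    (ha : a ∈ (𝒱.Y 𝒱.ω 1).eigenspace (d : ℂ)) {u : U} {h : ℂ} (hu : u ∈ 𝓤.L0.eigenspace h)
    (κ : ℕ) (hκ : ∀ i ≥ 2 * (κ : ℤ), 𝓤.Y a i u = 0)
    {s : ℂ} (N : ℕ) (hN : ∀ n ≥ N, 𝓦.L0.eigenspace (s - (n : ℂ)) = ⊥) :
    I.trace (∑ j ∈ Finset.range (2 * (κ + 1)),
        ((Ring.choose d j : ℤ) : ℂ) • 𝓤.Y a (-2 + j) u) s =
      -∑ k ∈ Finset.range κ, 2 / ((2 * k).factorial : ℂ) *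
        ∑ n ∈ Finset.Ico 1 N, (∑ e ∈ n.divisors, (e : ℂ) ^ (2 * k + 1)) *
          I.trace (𝓤.bracket a ((2 * k : ℕ) : ℤ) u) (s - (n : ℂ)) := by
  rw [trace_eq_gradedTrace, 𝓦.gradedTrace_congr
    (B := ∑ i ∈ Finset.range N, ((i : ℂ) + 1) •
        ((𝓦.Y a (d - 2 - i) * I.I u (h + i)) - (I.I u (h - 2 - i) * 𝓦.Y a (d + i))))]
  · simp only [map_sum, map_smul, map_sub, smul_eq_mul]
    rw [← Finset.sum_neg_distrib]
    simp only [← sum_sum_pow_mul_eq_sum_divisors _ s N _ fun n hn => I.trace_of_eq_bot _ (hN n hn)]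
    have hK : ∀ i ≥ ((2 * κ : ℕ) : ℤ), 𝓤.Y a i u = 0 := by simpa using hκ
    simp only [I.gradedTrace_Y_mul_I ha hu (2 * κ) hK _ N hN,
      I.gradedTrace_I_mul_Y ha hu (2 * κ) hK _ N hN, sum_range_two_mul]
    simp only [Finset.mul_sum, ← Finset.sum_neg_distrib, ← Finset.sum_sub_distrib]
    rw [Finset.sum_comm' (s := Finset.range κ) (t' := Finset.range N)
      (s' := fun _ => Finset.range κ) (t := fun _ => Finset.range N) (by simp)]
    refine Finset.sum_congr rfl fun i _ => ?_
    rw [Finset.sum_comm]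
    refine Finset.sum_congr rfl fun k _ => ?_
    refine Finset.sum_congr rfl fun j _ => ?_
    -- The two families of mode products contribute `(-m)^k` and `m^k` with the same sign, so odd
    -- `k` cancel and even `k` double.
    have h1 : (-((i : ℂ) + 1)) ^ (2 * k) = ((i : ℂ) + 1) ^ (2 * k) := by
      rw [pow_mul, neg_sq, ← pow_mul]
    have h2 : (-((i : ℂ) + 1)) ^ (2 * k + 1) = -((i : ℂ) + 1) ^ (2 * k + 1) := by
      rw [pow_succ, h1, pow_succ]
      ring
    rw [h1, h2]
    ring
  · intro x hx
    rw [I.o_residue_modes ha hu (2 * (κ + 1)) _ N hN hx, LinearMap.sum_apply]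
    · rfl
    · intro i hi
      exact hκ _ (by push_cast at hi; lia)

/-- Both evaluations of `tr o(X)` meet here: the expansion of `X` gives the constant terms of the
Eisenstein series and `trace_residue` the remaining ones. -/
theorem IntertwiningOperator.trace_identity_of_mem (I : IntertwiningOperator 𝓤 𝓦 𝓦) {a : V}
    {d : ℤ} (ha : a ∈ (𝒱.Y 𝒱.ω 1).eigenspace (d : ℂ)) {u : U} {h : ℂ}
    (hu : u ∈ 𝓤.L0.eigenspace h) (κ : ℕ) (hκ : ∀ i ≥ 2 * (κ : ℤ), 𝓤.Y a i u = 0)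
    {s : ℂ} (N : ℕ) (hN : ∀ n ≥ N, 𝓦.L0.eigenspace (s - (n : ℂ)) = ⊥) :
    I.trace (𝓤.bracket a (-2) u) s + ∑ k ∈ Finset.Ico 1 (κ + 1), (2 * (k : ℂ) - 1) *
      ∑ n ∈ Finset.range N, PowerSeries.coeff n (eisensteinSeries_q (2 * k)) *
        I.trace (𝓤.bracket a (2 * (k : ℤ) - 2) u) (s - (n : ℂ)) = 0 := by
  have hX : ∑ j ∈ Finset.range (2 * (κ + 1)), ((Ring.choose d j : ℤ) : ℂ) • 𝓤.Y a (-2 + j) u =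
      𝓤.bracket a (-2) u + ∑ k ∈ Finset.Ico 1 (κ + 1), ((2 * (k : ℂ) - 1) *
        PowerSeries.coeff 0 (eisensteinSeries_q (2 * k))) • 𝓤.bracket a (2 * (k : ℤ) - 2) u := by
    have hbr (m : ℤ) (hm : -2 ≤ m) := 𝓤.bracket_eq_sum ha (-2) m hm u (2 * (κ + 1))
      fun i hi => hκ i (by push_cast at hi; lia)
    have hR : ∑ k ∈ Finset.Ico 1 (κ + 1), ((2 * (k : ℂ) - 1) *
        PowerSeries.coeff 0 (eisensteinSeries_q (2 * k))) • 𝓤.bracket a (2 * (k : ℤ) - 2) u =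
        ∑ k ∈ Finset.Ico 1 (κ + 1), ∑ j ∈ Finset.range (2 * (κ + 1)), ((2 * (k : ℂ) - 1) *
          PowerSeries.coeff 0 (eisensteinSeries_q (2 * k)) *
            bracketCoeff d (2 * k - 2) (-2 + j)) • 𝓤.Y a (-2 + j) u := by
      refine Finset.sum_congr rfl fun k hk => ?_
      rw [hbr (2 * (k : ℤ) - 2) (by rw [Finset.mem_Ico] at hk; lia)]
      simp only [Finset.smul_sum, smul_smul]
    rw [hbr _ le_rfl, hR, Finset.sum_comm, ← Finset.sum_add_distrib]
    refine Finset.sum_congr rfl fun j hj => ?_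
    rw [choose_eq_sum_bracketCoeff d j (κ + 1) (Finset.mem_range.mp hj), add_smul,
      Finset.sum_smul, show (j : ℤ) - 2 = -2 + j by ring]
  have htr := I.trace_residue ha hu κ hκ N hN
  rw [hX, trace_eq_gradedTrace, map_add, map_add, map_sum, map_sum] at htr
  simp only [map_smul, smul_eq_mul, ← trace_eq_gradedTrace] at htr
  rcases Nat.eq_zero_or_pos N with rfl | hNpos
  · have h0 : 𝓦.L0.eigenspace s = ⊥ := by simpa using hN 0 le_rfl
    simp [I.trace_of_eq_bot _ h0]
  · have hsplit (k : ℕ) : ∑ n ∈ Finset.range N,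
        PowerSeries.coeff n (eisensteinSeries_q (2 * k)) *
          I.trace (𝓤.bracket a (2 * (k : ℤ) - 2) u) (s - (n : ℂ)) =
        PowerSeries.coeff 0 (eisensteinSeries_q (2 * k)) *
          I.trace (𝓤.bracket a (2 * (k : ℤ) - 2) u) s +
        ∑ n ∈ Finset.Ico 1 N, PowerSeries.coeff n (eisensteinSeries_q (2 * k)) *
          I.trace (𝓤.bracket a (2 * (k : ℤ) - 2) u) (s - (n : ℂ)) := by
      rw [Finset.range_eq_Ico, Finset.sum_eq_sum_Ico_succ_bot hNpos]
      simp
    simp only [hsplit, mul_add, Finset.sum_add_distrib, ← mul_assoc]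
    -- After the shift `k ↦ k + 1` the coefficients agree because `(2k+1) · 2/(2k+1)! = 2/(2k)!`.
    rw [← add_assoc, htr, neg_add_eq_zero, Finset.sum_Ico_eq_sum_range]
    refine Finset.sum_congr rfl fun k _ => ?_
    rw [show 2 * ((1 + k : ℕ) : ℤ) - 2 = ((2 * k : ℕ) : ℤ) by push_cast; ring,
      Finset.mul_sum, Finset.mul_sum]
    refine Finset.sum_congr rfl fun n hn => ?_
    have hn0 : n ≠ 0 := by rw [Finset.mem_Ico] at hn; lia
    rw [eisensteinSeries_q, PowerSeries.coeff_mk, if_neg hn0,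
      show 2 * (1 + k) - 1 = 2 * k + 1 by lia, Nat.factorial_succ]
    have hf : ((2 * k).factorial : ℂ) ≠ 0 := by exact_mod_cast Nat.factorial_ne_zero _
    have hk : (2 * (k : ℂ) + 1) ≠ 0 := by exact_mod_cast Nat.succ_ne_zero (2 * k)
    push_cast
    rw [show 2 * (1 + (k : ℂ)) - 1 = 2 * k + 1 by ring]
    field_simp

/-! ### Extension to all `a` and `u` -/

theorem qMul_eq_sum (e : PowerSeries ℂ) (t : ℂ → ℂ) (s : ℂ) (N : ℕ)
    (hN : ∀ n ≥ N, t (s - (n : ℂ)) = 0) :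
    qMul e t s = ∑ n ∈ Finset.range N, PowerSeries.coeff n e * t (s - (n : ℂ)) :=
  finsum_eq_sum_range_of_eq_zero _ N fun n hn => by rw [hN n hn, mul_zero]

theorem IntertwiningOperator.qMul_trace_add (I : IntertwiningOperator 𝓤 𝓦 𝓦) (e : PowerSeries ℂ)
    (u v : U) (s : ℂ) :
    qMul e (I.trace (u + v)) s = qMul e (I.trace u) s + qMul e (I.trace v) s := by
  obtain ⟨N, hN⟩ := 𝓦.exists_eigenspace_eq_bot s
  rw [qMul_eq_sum _ _ s N fun n hn => I.trace_of_eq_bot _ (hN n hn),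
    qMul_eq_sum _ _ s N fun n hn => I.trace_of_eq_bot _ (hN n hn),
    qMul_eq_sum _ _ s N fun n hn => I.trace_of_eq_bot _ (hN n hn), ← Finset.sum_add_distrib]
  simp only [trace_add, Pi.add_apply, mul_add]

theorem qMul_zero (e : PowerSeries ℂ) (s : ℂ) : qMul e 0 s = 0 := by
  simp [qMul]

theorem IntertwiningOperator.trace_bracket_zero (I : IntertwiningOperator 𝓤 𝓦 𝓦) (a : V) (u : U) :
    I.trace (𝓤.bracket a 0 u) = 0 := by
  induction a using 𝒱.grading.induction_on with
  | mem d a ha =>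
    induction u using (show DirectSum.IsInternal fun h : ℂ => 𝓤.L0.eigenspace h
      from 𝓤.grading).induction_on with
    | mem h u hu => exact I.trace_bracket_zero_of_mem ha hu
    | add u v hu hv => rw [𝓤.bracket_add_right, I.trace_add, hu, hv, add_zero]
    | zero => rw [𝓤.bracket_zero_right, I.trace_zero]
  | add a b ha hb => rw [𝓤.bracket_add_left, I.trace_add, ha, hb, add_zero]
  | zero => rw [𝓤.bracket_zero_left, I.trace_zero]

/-- The second trace identity, with the sum over `k` truncated at `κ`. -/
def IntertwiningOperator.TraceIdentity (I : IntertwiningOperator 𝓤 𝓦 𝓦) (a : V) (u : U)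
    (κ : ℕ) : Prop :=
  (∀ k ≥ κ, 𝓤.bracket a (2 * (k : ℤ) - 2) u = 0) ∧
  ∀ s : ℂ, I.trace (𝓤.bracket a (-2) u) s + ∑ k ∈ Finset.Ico 1 κ, (2 * (k : ℂ) - 1) *
    qMul (eisensteinSeries_q (2 * k)) (I.trace (𝓤.bracket a (2 * (k : ℤ) - 2) u)) s = 0

theorem IntertwiningOperator.exists_traceIdentity_of_mem (I : IntertwiningOperator 𝓤 𝓦 𝓦) {a : V}
    {d : ℤ} (ha : a ∈ (𝒱.Y 𝒱.ω 1).eigenspace (d : ℂ)) {u : U} {h : ℂ}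
    (hu : u ∈ 𝓤.L0.eigenspace h) : ∃ κ₀ : ℕ, ∀ κ ≥ κ₀, I.TraceIdentity a u κ := by
  obtain ⟨M, hM⟩ := 𝓤.truncation a u
  refine ⟨M.toNat + 1, fun κ hκ => ⟨fun k hk => ?_, fun s => ?_⟩⟩
  · rw [𝓤.bracket_eq_sum ha (2 * (k : ℤ) - 2) _ le_rfl u 0 fun i hi => hM i (by lia)]
    simp
  · obtain ⟨N, hN⟩ := 𝓦.exists_eigenspace_eq_bot s
    have := I.trace_identity_of_mem ha hu (κ - 1) (fun i hi => hM i (by lia)) N hN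
    rw [Nat.sub_add_cancel (by lia)] at this
    simpa only [qMul_eq_sum _ _ s N fun n hn => I.trace_of_eq_bot _ (hN n hn)] using this

/-- Asking for every `κ ≥ κ₀` makes the statement additive in `a` and in `u`: two summands can be
compared at a common truncation. -/
theorem IntertwiningOperator.exists_traceIdentity (I : IntertwiningOperator 𝓤 𝓦 𝓦) (a : V)
    (u : U) : ∃ κ₀ : ℕ, ∀ κ ≥ κ₀, I.TraceIdentity a u κ := by
  induction a using 𝒱.grading.induction_on with
  | mem d a ha =>
    induction u using (show DirectSum.IsInternal fun h : ℂ => 𝓤.L0.eigenspace h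
      from 𝓤.grading).induction_on with
    | mem h u hu => exact I.exists_traceIdentity_of_mem ha hu
    | add u v hu hv =>
      obtain ⟨κ₁, h₁⟩ := hu
      obtain ⟨κ₂, h₂⟩ := hv
      refine ⟨max κ₁ κ₂, fun κ hκ => ⟨fun k hk => ?_, fun s => ?_⟩⟩
      · rw [𝓤.bracket_add_right, (h₁ κ (by lia)).1 k hk, (h₂ κ (by lia)).1 k hk, add_zero]
      · have e₁ := (h₁ κ (by lia)).2 s
        have e₂ := (h₂ κ (by lia)).2 s
        simp only [𝓤.bracket_add_right, I.qMul_trace_add, mul_add, Finset.sum_add_distrib]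
        rw [I.trace_add, Pi.add_apply]
        linear_combination e₁ + e₂
    | zero =>
      refine ⟨0, fun κ _ => ⟨fun k _ => 𝓤.bracket_zero_right _ _, fun s => ?_⟩⟩
      simp [𝓤.bracket_zero_right, I.trace_zero, qMul_zero]
  | add a b ha hb =>
    obtain ⟨κ₁, h₁⟩ := ha
    obtain ⟨κ₂, h₂⟩ := hb
    refine ⟨max κ₁ κ₂, fun κ hκ => ⟨fun k hk => ?_, fun s => ?_⟩⟩
    · rw [𝓤.bracket_add_left, (h₁ κ (by lia)).1 k hk, (h₂ κ (by lia)).1 k hk, add_zero]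
    · have e₁ := (h₁ κ (by lia)).2 s
      have e₂ := (h₂ κ (by lia)).2 s
      simp only [𝓤.bracket_add_left, I.qMul_trace_add, mul_add, Finset.sum_add_distrib]
      rw [I.trace_add, Pi.add_apply]
      linear_combination e₁ + e₂
  | zero =>
    refine ⟨0, fun κ _ => ⟨fun k _ => 𝓤.bracket_zero_left _ _, fun s => ?_⟩⟩
    simp [𝓤.bracket_zero_left, I.trace_zero, qMul_zero]

end TraceIdentity

/-! ### Convergence -/

section Convergence

open Complex EisensteinSeries

theorem coeff_eisensteinSeries_q_of_ne_zero (k : ℕ) {n : ℕ} (hn : n ≠ 0) :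
    PowerSeries.coeff n (eisensteinSeries_q k) =
      2 / ((k - 1).factorial : ℂ) * (ArithmeticFunction.sigma (k - 1) n : ℂ) := by
  rw [eisensteinSeries_q, PowerSeries.coeff_mk, if_neg hn, ArithmeticFunction.sigma_apply]
  push_cast
  rfl

theorem summable_coeff_eisensteinSeries_q {k : ℕ} (hk : 1 ≤ k) (τ : ℍ) :
    Summable fun n : ℕ => PowerSeries.coeff n (eisensteinSeries_q k) *
      cexp (2 * Real.pi * Complex.I * τ) ^ n := by
  rw [← summable_nat_add_iff 1]
  refine (((summable_nat_add_iff 1).mpr (summable_sigma_mul_cexp_pow hk τ)).mul_left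
    (2 / ((k - 1).factorial : ℂ))).congr fun n => ?_
  rw [coeff_eisensteinSeries_q_of_ne_zero k n.succ_ne_zero, mul_assoc (2 / _ : ℂ)]

/-- The classical `q`-expansion of the lattice sum, renormalised by `(2πi)^k`; evenness identifies
`(-2πi)^k` with `(2πi)^k`. -/
theorem tsum_coeff_eisensteinSeries_q {k : ℕ} (hk : 3 ≤ k) (hk2 : Even k) (τ : ℍ) :
    ∑' n : ℕ, PowerSeries.coeff n (eisensteinSeries_q k) *
      cexp (2 * Real.pi * Complex.I * τ) ^ n = eisensteinFun k τ := by
  have hpi : (2 * Real.pi * Complex.I : ℂ) ^ k ≠ 0 := pow_ne_zero _ two_pi_I_ne_zero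
  have hs := summable_coeff_eisensteinSeries_q (k := k) (by lia) τ
  have hmain := tsum_eisSummand_eq_tsum_sigma_mul_cexp_pow hk hk2 τ
  have hlat : ∑' p : {p : ℤ × ℤ // p ≠ 0}, 1 / ((p.1.1 : ℂ) * (τ : ℂ) + (p.1.2 : ℂ)) ^ k =
      ∑' v, eisSummand k v τ := by
    rw [← (finTwoArrowEquiv ℤ).symm.tsum_eq]
    -- The summand at the origin is `0` by the convention for division by zero, so the full lattice
    -- sum agrees with the punctured one.
    rw [← tsum_subtype_eq_of_support_subset (s := {p : ℤ × ℤ | p ≠ 0})]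
    · refine tsum_congr fun p => ?_
      simp [eisSummand]
    · intro p hp h0
      apply hp
      simp [h0, eisSummand]
      lia
  rw [eisensteinFun, hlat, hmain, hs.tsum_eq_zero_add,
    tsum_pnat_eq_tsum_succ (f := fun n => (ArithmeticFunction.sigma (k - 1) n : ℂ) *
      cexp (2 * Real.pi * Complex.I * τ) ^ n)]
  simp only [coeff_eisensteinSeries_q_of_ne_zero k (Nat.succ_ne_zero _), mul_assoc (2 / _ : ℂ),
    tsum_mul_left]
  rw [eisensteinSeries_q, PowerSeries.coeff_mk, if_pos rfl,
    show (-2 * Real.pi * Complex.I : ℂ) ^ k = (2 * Real.pi * Complex.I) ^ k by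
      rw [show (-2 * Real.pi * Complex.I : ℂ) = -(2 * Real.pi * Complex.I) by ring, hk2.neg_pow]]
  field_simp

theorem qMul_converges (e : PowerSeries ℂ) (t : ℂ → ℂ) (τ : ℍ)
    (ht : ∀ s : ℂ, ∃ N : ℕ, ∀ n ≥ N, t (s - (n : ℂ)) = 0)
    (he : Summable fun n : ℕ => PowerSeries.coeff n e * cexp (2 * Real.pi * Complex.I * τ) ^ n)
    (hc : QConverges t τ) :
    QConverges (qMul e t) τ ∧ qValue (qMul e t) τ =
      (∑' n : ℕ, PowerSeries.coeff n e * cexp (2 * Real.pi * Complex.I * τ) ^ n) * qValue t τ := by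
  set f : ℕ → ℂ := fun n => PowerSeries.coeff n e * cexp (2 * Real.pi * Complex.I * τ) ^ n with hf
  have hterm : qTerm (qMul e t) τ = fun s : ℂ => ∑' n : ℕ, f n * qTerm t τ (s - n) := by
    ext s
    obtain ⟨N, hN⟩ := ht s
    rw [tsum_eq_sum (s := Finset.range N), qTerm, qMul_eq_sum e t s N hN, Finset.sum_mul]
    · refine Finset.sum_congr rfl fun n _ => ?_
      have : cexp (2 * Real.pi * Complex.I * τ * s) =
          cexp (2 * Real.pi * Complex.I * τ) ^ n * cexp (2 * Real.pi * Complex.I * τ * (s - n)) := by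
        rw [← Complex.exp_nat_mul, ← Complex.exp_add]
        ring_nf
      rw [hf, qTerm, this]
      ring
    · intro n hn
      rw [qTerm, hN n (by simpa using hn)]
      simp
  -- The bijection `(s, n) ↦ (n, s - n)` turns the convolution into a product of two absolutely
  -- summable families, so Fubini applies even though the exponents range over all of `ℂ`.
  let shear : ℂ × ℕ ≃ ℕ × ℂ :=
    { toFun := fun p => (p.2, p.1 - p.2)
      invFun := fun p => (p.2 + p.1, p.1)
      left_inv := fun p => by simp
      right_inv := fun p => by simp }
  have hprod : Summable fun p : ℕ × ℂ => f p.1 * qTerm t τ p.2 :=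
    summable_mul_of_summable_norm he.norm hc.norm
  have hshear : Summable fun p : ℂ × ℕ => f p.2 * qTerm t τ (p.1 - p.2) :=
    shear.summable_iff.mpr hprod
  constructor
  · rw [QConverges, hterm]
    exact hshear.prod
  · rw [qValue, hterm, qValue, tsum_mul_tsum_of_summable_norm he.norm hc.norm,
      ← hshear.tsum_prod]
    exact shear.tsum_eq fun p : ℕ × ℂ => f p.1 * qTerm t τ p.2

theorem finsum_two_le_eq_sum {F : ℕ → ℂ} {κ : ℕ} (hF : ∀ k ≥ κ, F k = 0) :
    ∑ᶠ (k : ℕ) (_ : 2 ≤ k), F k = ∑ k ∈ Finset.Ico 2 κ, F k := by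
  apply finsum_cond_eq_sum_of_cond_iff
  intro k hk
  rw [Finset.mem_Ico]
  refine ⟨fun h => ⟨h, ?_⟩, fun h => h.1⟩
  by_contra hc
  exact hk (hF k (by lia))

end Convergence

end

theorem theorem3p4 {V U W : Type*} [AddCommGroup V] [Module ℂ V]
    [AddCommGroup U] [Module ℂ U] [AddCommGroup W] [Module ℂ W]
    (𝒱 : VertexOperatorAlgebra V) (𝓤 : VOAModule 𝒱 U) (𝓦 : VOAModule 𝒱 W)
    (I : IntertwiningOperator 𝓤 𝓦 𝓦) (a : V) (u : U) :
    -- first identity, between formal series in `q`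
    I.trace (𝓤.bracket a 0 u) = 0 ∧
    -- the sums over `k` below are finite
    (∃ K : ℕ, ∀ k ≥ K, 𝓤.bracket a (2 * (k : ℤ) - 2) u = 0) ∧
    -- second identity, between formal series in `q`
    (∀ s : ℂ, I.trace (𝓤.bracket a (-2) u) s +
      ∑ᶠ (k : ℕ) (_ : 2 ≤ k), (2 * (k : ℂ) - 1) *
        qMul (eisensteinSeries_q (2 * k)) (I.trace (𝓤.bracket a (2 * (k : ℤ) - 2) u)) s = 0) ∧
    -- second identity, between values at a point `τ` where the traces converge
    (∀ τ : ℍ,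
      (∀ k : ℕ, 2 ≤ k → QConverges (I.trace (𝓤.bracket a (2 * (k : ℤ) - 2) u)) τ) →
      QConverges (I.trace (𝓤.bracket a (-2) u)) τ ∧
      qValue (I.trace (𝓤.bracket a (-2) u)) τ +
        ∑ᶠ (k : ℕ) (_ : 2 ≤ k), (2 * (k : ℂ) - 1) * eisensteinFun (2 * k) τ *
          qValue (I.trace (𝓤.bracket a (2 * (k : ℤ) - 2) u)) τ = 0) := by
  obtain ⟨κ₀, hκ₀⟩ := I.exists_traceIdentity a u
  obtain ⟨hzero, hid⟩ := hκ₀ (κ₀ + 1) (by lia)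
  -- The `k = 1` term carries `tr o(a[0]u) = 0`, so the formal `E_2` disappears.
  have hid' (s : ℂ) : I.trace (𝓤.bracket a (-2) u) s +
      ∑ k ∈ Finset.Ico 2 (κ₀ + 1), (2 * (k : ℂ) - 1) * qMul (eisensteinSeries_q (2 * k))
        (I.trace (𝓤.bracket a (2 * (k : ℤ) - 2) u)) s = 0 := by
    have h := hid s
    rcases Nat.eq_zero_or_pos κ₀ with h0 | hpos
    · simpa [h0] using h
    · rw [Finset.sum_eq_sum_Ico_succ_bot (by lia)] at h
      simpa [I.trace_bracket_zero, qMul_zero] using h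
  refine ⟨I.trace_bracket_zero a u, ⟨κ₀ + 1, hzero⟩, fun s => ?_, fun τ hτ => ?_⟩
  · rw [finsum_two_le_eq_sum (κ := κ₀ + 1), hid']
    intro k hk
    rw [hzero k hk, I.trace_zero, qMul_zero, mul_zero]
  · have hconv (k : ℕ) (hk : k ∈ Finset.Ico 2 (κ₀ + 1)) :=
      qMul_converges (eisensteinSeries_q (2 * k)) (I.trace (𝓤.bracket a (2 * (k : ℤ) - 2) u)) τ
        (fun s => by
          obtain ⟨N, hN⟩ := 𝓦.exists_eigenspace_eq_bot s
          exact ⟨N, fun n hn => I.trace_of_eq_bot _ (hN n hn)⟩)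
        (summable_coeff_eisensteinSeries_q (by rw [Finset.mem_Ico] at hk; lia) τ)
        (hτ k (Finset.mem_Ico.mp hk).1)
    -- Solving the formal identity for the `a[-2]u` series exhibits it as a finite combination of
    -- convergent products, which gives both its convergence and its value.
    have hterm : qTerm (I.trace (𝓤.bracket a (-2) u)) τ = fun s =>
        ∑ k ∈ Finset.Ico 2 (κ₀ + 1), -(2 * (k : ℂ) - 1) * qTerm (qMul (eisensteinSeries_q (2 * k))
          (I.trace (𝓤.bracket a (2 * (k : ℤ) - 2) u))) τ s := by
      ext s
      simp only [qTerm]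
      rw [eq_neg_of_add_eq_zero_left (hid' s), ← Finset.sum_neg_distrib, Finset.sum_mul]
      exact Finset.sum_congr rfl fun k _ => by ring
    have hsum (k : ℕ) (hk : k ∈ Finset.Ico 2 (κ₀ + 1)) :
        Summable fun s => -(2 * (k : ℂ) - 1) * qTerm (qMul (eisensteinSeries_q (2 * k))
          (I.trace (𝓤.bracket a (2 * (k : ℤ) - 2) u))) τ s :=
      (hconv k hk).1.mul_left _
    refine ⟨?_, ?_⟩
    · rw [QConverges, hterm]
      exact summable_sum hsum
    · rw [finsum_two_le_eq_sum (κ := κ₀ + 1)]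
      · rw [qValue, hterm, Summable.tsum_finsetSum hsum, ← Finset.sum_add_distrib]
        refine Finset.sum_eq_zero fun k hk => ?_
        have hk2 := (Finset.mem_Ico.mp hk).1
        have hval := (hconv k hk).2
        rw [tsum_coeff_eisensteinSeries_q (by lia) (even_two_mul k), qValue] at hval
        rw [tsum_mul_left, hval]
        ring
      · intro k hk
        rw [hzero k hk, I.trace_zero]
        simp [qValue, qTerm]
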